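/- **Conventions.** Let $\tau$ be a finite vocabulary consisting of predicates of positive arity, let $|\tau|$ be the number of its predicates, and let $\tau^+=\tau\cup\{\in\}$. Models are finite and non-empty, and $\|M\|$ is the number of elements of $M$. *Random models.* For $\mathbf s:\mathbb N\to\mathbb N\cup\{\infty\}$ and $k\in\mathbb N$, a $\tau$-model $M$ is $(\mathbf s,k)$-random if for every $A\subseteq M$ with $|A|<k$, every complete quantifier-free 1-type $p(x)$ over $A$ which contains $x\ne a$ for all $a\in A$ (that is, every choice, for each atomic formula $R(z_1,\dots,z_n)$ with $R\in\tau$, $z_i\in A\cup\{x\}$, in which $x$ occurs, of this formula or its negation) is realized in $M$ by at least $\mathbf s(\|M\|)$ elements. *Inductive schemes.* An inductive scheme $\Upsilon$ for first order logic over $\tau^+$ consists of formulas $\psi_k(x,\bar y_k)$ ($k<m_0$) and $\varphi_\ell(x)$ ($\ell<m_1$) of first order logic in the vocabulary $\tau^+\cup\{\mathcal P_\ell:\ell<m_1\}$ with unary predicates $\mathcal P_\ell$; $m_{fv}(\Upsilon)=\max_k \mathrm{lg}(\bar y_k)$. Let $M$ be a $\tau$-model, whose elements are regarded as urelements. Let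 $V_0[M]=M$ and $V_{t+1}[M]=V_t[M]\cup\{a:a\subseteq V_t[M]\}$, where the predicates of $\tau$ hold only of tuples from $M$, as in $M$. Define $N_t=N_t[M,\Upsilon]\subseteq V_t[M]$ by $N_0=M$ and $N_{t+1}=N_t\cup\bigcup_{k<m_0}\mathcal P_{t,k}$, where $$\mathcal P_{t,k}=\bigl\{\{a\in N_t: N_t^+\models\psi_k(a,\bar b)\}:\bar b\in{}^{\mathrm{lg}(\bar y_k)}N_t\bigr\},\qquad c_{t,\ell}=\{a\in N_t:N_t^+\models\varphi_\ell(a)\},$$ and $N_t^+$ is the submodel $N_t$ of $V_t[M]$ expanded by interpreting $\mathcal P_\ell$ as $P_{t,\ell}$, with $P_{0,\ell}=\emptyset$ and $P_{t+1,\ell}=\{c_{t,\ell}\}\cap N_{t+1}$. *Truth values.* Let $\mathbf t:\mathbb N\to\mathbb N\cup\{\infty\}$, $T=\mathbf t(\|M\|)$ and $\iota\in\{2,3,4\}$. The step from time $t$ to time $t+1$ is too expensive if: $\|N_{t+1}\|+(t+1)>T$ (for $\iota=2$); $\|N_{t+1}\|>T$ (for $\iota=3$); $|\mathcal P_{t,k}|>T$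 for some $k<m_0$ (for $\iota=4$). The target is reached at time $t$ if $m_1\ge2$ and $c_{t,0}=c_{t,1}$. The stopping time $t_\iota[M,\Upsilon,\mathbf t]$ is the least $t$ (or $\infty$ if there is none) such that the target is reached at time $t$, or the step from $t$ to $t+1$ is too expensive, or $t+1\ge T$. For a sentence $\chi$ of first order logic over $\tau^+$, the truth value of $\theta_{\Upsilon,\chi,\mathbf t}$ in $M$ (in the sense $\iota$) is defined if $t=t_\iota[M,\Upsilon,\mathbf t]$ is finite and the target is reached at time $t$, and then it is the truth value of $\chi$ in $N_t[M,\Upsilon]$; otherwise it is undefined. **Claim.** Let $k,s\in\mathbb N$, $\mathbf s_\ell,\mathbf t_\ell:\mathbb N\to\mathbb N\cup\{\infty\}$ and let $M_\ell$ be a $\tau$-model, for $\ell=1,2$. Assume (a) $M_\ell$ is $(\mathbf s_\ell,k)$-random for $\ell=1,2$; (b) $3s\le k$; (c) $2^{2^s\cdot|\tau|}<\mathbf t_\ell(\|M_\ell\|)$ and $\mathbf t_\ell(\|M_\ell\|)+s<\mathbf s_\ell(\|M_\ell\|)$ for $\ell=1,2$; (d) $\Upsilon$ is an inductive scheme for first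 order logic over $\tau^+$, $\chi$ is a first order sentence over $\tau^+$, $m_{fv}(\Upsilon)\le s$, and each subformula of $\chi$ or of any formula of $\Upsilon$ has at most $s$ free variables. Then for each $\iota\in\{2,3,4\}$ the truth value of $\theta_{\Upsilon,\chi,\mathbf t_1}$ in $M_1$ and that of $\theta_{\Upsilon,\chi,\mathbf t_2}$ in $M_2$ are equal (both true, both false, or both undefined), except possibly when for some $\ell\in\{1,2\}$ the truth value of $\theta_{\Upsilon,\chi,\mathbf t_\ell}$ in $M_\ell$ is undefined, that of $\theta_{\Upsilon,\chi,\mathbf t_{3-\ell}}$ in $M_{3-\ell}$ is defined, and $t_\iota[M_\ell,\Upsilon,\mathbf t_\ell]<t_\iota[M_{3-\ell},\Upsilon,\mathbf t_{3-\ell}]$. -/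

import Mathlib

open FirstOrder

universe u v w w'

namespace CPT

/-! ### Vocabularies -/

/-- The symbol `∈`. -/
inductive MemRel : ℕ → Type
  | mem : MemRel 2

/-- The vocabulary whose only symbol is the binary predicate `∈`. -/
abbrev memLang : FirstOrder.Language.{0, 0} := ⟨fun _ => Empty, MemRel⟩

/-- The unary predicate symbols `𝒫_ℓ`, `ℓ < m`. -/
inductive DynRel (m : ℕ) : ℕ → Type
  | pred (ℓ : Fin m) : DynRel m 1

/-- The vocabulary consisting of the unary predicates `𝒫_ℓ`, `ℓ < m`. -/
abbrev dynLang (m : ℕ) : FirstOrder.Language.{0, 0} := ⟨fun _ => Empty, DynRel m⟩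

/-- `τ⁺ = τ ∪ {∈}`. -/
abbrev plus (L : FirstOrder.Language.{u, v}) : FirstOrder.Language.{u, v} := L.sum memLang

/-- `τ₂ = τ⁺ ∪ {𝒫_ℓ : ℓ < m}`. -/
abbrev plusDyn (L : FirstOrder.Language.{u, v}) (m : ℕ) : FirstOrder.Language.{u, v} := (plus L).sum (dynLang m)

/-! ### Free variables of subformulas -/

section Width

variable {L : FirstOrder.Language.{u, v}} {α : Type}

/-- The variables that occur free in a formula of a vocabulary without function symbols (so that
every term is a variable); `Sum.inr i` is the variable with de Bruijn level
`i`, which counts as free until the quantifier that binds it is reached. -/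
def freeVars : {n : ℕ} → L.BoundedFormula α n → Set (α ⊕ Fin n)
  | _, .falsum => ∅
  | _, .equal t₁ t₂ => {x | (∃ y, t₁ = .var y ∧ x = y) ∨ (∃ y, t₂ = .var y ∧ x = y)}
  | _, .rel _ ts => {x | ∃ i, ts i = .var x}
  | _, .imp φ ψ => freeVars φ ∪ freeVars ψ
  | _, .all φ => {x | Sum.map id Fin.castSucc x ∈ freeVars φ}

/-- Every subformula (the formula itself included) has at most `s` free variables. -/
def WidthLE (s : ℕ) : {n : ℕ} → L.BoundedFormula α n → Prop
  | _, .falsum => True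
  | _, .equal t₁ t₂ => (freeVars (FirstOrder.Language.BoundedFormula.equal t₁ t₂)).encard ≤ s
  | _, .rel R ts => (freeVars (FirstOrder.Language.BoundedFormula.rel R ts)).encard ≤ s
  | _, .imp φ ψ => (freeVars (φ.imp ψ)).encard ≤ s ∧ WidthLE s φ ∧ WidthLE s ψ
  | _, .all φ => (freeVars φ.all).encard ≤ s ∧ WidthLE s φ

end Width

/-! ### Sets of finite rank over the urelements `M` -/

/-- `V₀[M] = M` and `V_{t+1}[M] = V_t[M] ∪ {a : a ⊆ V_t[M]} = M ∪ {a : a ⊆ V_t[M]}`; the elements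
of `M` are urelements, so they are kept apart from the sets. -/
def V (M : Type w) : ℕ → Type w
  | 0 => M
  | t + 1 => M ⊕ Set (V M t)

variable {M : Type w}

/-- An element of `M` as an element of `V_t[M]`. -/
def ur : (t : ℕ) → M → V M t
  | 0, a => a
  | _ + 1, a => Sum.inl a

/-- A subset of `V_t[M]` as an element of `V_{t+1}[M]`. -/
def ofSet {t : ℕ} (X : Set (V M t)) : V M (t + 1) := Sum.inr X

/-- The inclusion of `V_t[M]` in `V_{t+1}[M]`. -/
def lift : (t : ℕ) → V M t → V M (t + 1)
  | 0, a => Sum.inl a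
  | _ + 1, Sum.inl a => Sum.inl a
  | t + 1, Sum.inr X => Sum.inr (lift t '' X)

/-- The relation `∈` on `V_t[M]`. -/
def mem : (t : ℕ) → V M t → V M t → Prop
  | 0, _, _ => False
  | t + 1, x, y => ∃ X : Set (V M t), y = ofSet X ∧ ∃ z ∈ X, lift t z = x

/-! ### Submodels of `V_t[M]` -/

/-- The predicates of `τ` are interpreted in a submodel of `V_t[M]` as in `M`: they hold of
tuples of urelements only. -/
instance baseStructure (L : FirstOrder.Language.{u, v}) [L.IsRelational] [L.Structure M] {t : ℕ}
    (N : Set (V M t)) : L.Structure N where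
  funMap f _ := isEmptyElim f
  RelMap R x := ∃ a : Fin _ → M, (∀ i, (x i : V M t) = ur t (a i)) ∧ FirstOrder.Language.Structure.RelMap R a

instance memStructure {t : ℕ} (N : Set (V M t)) : memLang.Structure N where
  funMap f _ := Empty.elim f
  RelMap R x := match R, x with
    | .mem, x => mem t (x 0 : V M t) (x 1 : V M t)

/-- The expansion of `N` by the unary predicates `P_ℓ`. -/
abbrev dynStructure {t m : ℕ} (N : Set (V M t)) (P : Fin m → Set (V M t)) :
    (dynLang m).Structure N where
  funMap f _ := Empty.elim f
  RelMap R x := match R, x with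
    | .pred ℓ, x => (x 0 : V M t) ∈ P ℓ

/-! ### Inductive schemes and their computations -/

/-- An inductive scheme `Υ = (ψ̄, φ̄, c̄)` for first order logic over `τ⁺`. In `ψ ℓ` the variable
`none` is `x` and the variables `some i` are the parameters `ȳ_ℓ`. -/
structure Scheme (L : FirstOrder.Language.{u, v}) where
  m₀ : ℕ
  m₁ : ℕ
  lenY : Fin m₀ → ℕ
  ψ : (ℓ : Fin m₀) → (plusDyn L m₁).Formula (Option (Fin (lenY ℓ)))
  φ : Fin m₁ → (plusDyn L m₁).Formula Unit

/-- `m_fv(Υ) ≤ s`, and each subformula of a formula of `Υ` has at most `s` free variables. -/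
def Scheme.Bounded {L : FirstOrder.Language.{u, v}} (Υ : Scheme L) (s : ℕ) : Prop :=
  (∀ ℓ, Υ.lenY ℓ ≤ s) ∧ (∀ ℓ, WidthLE s (Υ.ψ ℓ)) ∧ (∀ ℓ, WidthLE s (Υ.φ ℓ))

/-- A model `N_t⁺ = (N_t, P_{t,0}, …, P_{t,m-1})`: a set of elements of `V_t[M]` with `m` unary
predicates. -/
structure Stage (M : Type w) (m t : ℕ) where
  N : Set (V M t)
  P : Fin m → Set (V M t)

section Computation

variable {L : FirstOrder.Language.{u, v}} [L.IsRelational] [L.Structure M]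

/-- `N_t⁺ ⊨ θ[v]`, for a formula `θ` of the vocabulary `τ₂`. -/
def Stage.Sat {m t : ℕ} {α : Type} (S : Stage M m t) (θ : (plusDyn L m).Formula α)
    (v : α → S.N) : Prop :=
  letI := dynStructure S.N S.P
  θ.Realize v

/-- `N_t ⊨ χ`, for a sentence `χ` of the vocabulary `τ⁺`. -/
def Stage.SatSentence {m t : ℕ} (S : Stage M m t) (χ : (plus L).Sentence) : Prop :=
  S.N ⊨ χ

/-- The family `𝒫_{t,k}` of all sets `{a ∈ N_t : N_t⁺ ⊨ ψ_k(a, b̄)}` with `b̄` from `N_t`. -/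
def Stage.family (Υ : Scheme L) {t : ℕ} (S : Stage M Υ.m₁ t) (k : Fin Υ.m₀) :
    Set (Set (V M t)) :=
  {X | ∃ b : Fin (Υ.lenY k) → S.N,
    X = {a | ∃ ha : a ∈ S.N, S.Sat (Υ.ψ k) (fun i => i.elim ⟨a, ha⟩ b)}}

/-- `c_{t,ℓ} = {a ∈ N_t : N_t⁺ ⊨ φ_ℓ[a]}`. -/
def Stage.c (Υ : Scheme L) {t : ℕ} (S : Stage M Υ.m₁ t) (ℓ : Fin Υ.m₁) : Set (V M t) :=
  {a | ∃ ha : a ∈ S.N, S.Sat (Υ.φ ℓ) (fun _ => ⟨a, ha⟩)}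

/-- `N_{t+1} = N_t ∪ ⋃_k 𝒫_{t,k}`. -/
def Stage.nextN (Υ : Scheme L) {t : ℕ} (S : Stage M Υ.m₁ t) : Set (V M (t + 1)) :=
  lift t '' S.N ∪ ofSet '' (⋃ k, S.family Υ k)

/-- The step from `N_t⁺` to `N_{t+1}⁺`; here `P_{t+1,ℓ}` is `{c_{t,ℓ}}` as a unary relation on
`N_{t+1}`, so it is empty if `c_{t,ℓ}` is not an element of `N_{t+1}`. -/
def Stage.next (Υ : Scheme L) {t : ℕ} (S : Stage M Υ.m₁ t) : Stage M Υ.m₁ (t + 1) where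
  N := S.nextN Υ
  P ℓ := {y | y ∈ S.nextN Υ ∧ y = ofSet (S.c Υ ℓ)}

variable (M)

/-- The computation of `Υ` on `M`: `run M Υ t` is `N_t⁺[M, Υ]`, where `N_0 = M` and the
predicates `P_{0,ℓ}` are empty. -/
def run (Υ : Scheme L) : (t : ℕ) → Stage M Υ.m₁ t
  | 0 => ⟨Set.univ, fun _ => ∅⟩
  | t + 1 => (run Υ t).next Υ

/-! ### Stopping times and truth values -/

/-- The target condition `c_{t,0} = c_{t,1}` at time `t`. -/
def Halts (Υ : Scheme L) (t : ℕ) : Prop :=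
  ∃ i j : Fin Υ.m₁, i.val = 0 ∧ j.val = 1 ∧ (run M Υ t).c Υ i = (run M Υ t).c Υ j

/-- The three ways to charge for resources. -/
inductive Mode
  | two
  | three
  | four

/-- With budget `T`, the step from time `t` to time `t + 1` costs too much. -/
def Exceeds (Υ : Scheme L) (T : ℕ∞) (t : ℕ) : Mode → Prop
  | .two => T < (run M Υ (t + 1)).N.encard + ((t + 1 : ℕ) : ℕ∞)
  | .three => T < (run M Υ (t + 1)).N.encard
  | .four => ∃ k, T < ((run M Υ t).family Υ k).encard

/-- The computation stops at time `t`: the target condition holds, or the resources do not allow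
the next step, or time is up (`t + 1` is not below the budget). -/
def Stops (Υ : Scheme L) (T : ℕ∞) (ι : Mode) (t : ℕ) : Prop :=
  Halts M Υ t ∨ Exceeds M Υ T t ι ∨ T ≤ ((t + 1 : ℕ) : ℕ∞)

/-- The stopping time `t_ι[M, Υ, 𝐭] = min {t : the computation stops at t}` (`⊤` if there is no
such `t`), for the time function `𝐭`. -/
noncomputable def stopTime (Υ : Scheme L) (T : ℕ → ℕ∞) (ι : Mode) : ℕ∞ :=
  sInf {r : ℕ∞ | ∃ t : ℕ, r = t ∧ Stops M Υ (T (Nat.card M)) ι t}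

/-- The truth value of `θ_{Υ,χ,𝐭}` in `M` is defined: the computation stops because it has reached
its target, and not because time or resources ran out. -/
def Defined (Υ : Scheme L) (T : ℕ → ℕ∞) (ι : Mode) : Prop :=
  ∃ t : ℕ, stopTime M Υ T ι = t ∧ Halts M Υ t

/-- `M ⊨_ι θ_{Υ,χ,𝐭}`: the truth value is defined and `N_t ⊨ χ` for the stopping time `t`. -/
def Holds (Υ : Scheme L) (χ : (plus L).Sentence) (T : ℕ → ℕ∞) (ι : Mode) : Prop :=
  ∃ t : ℕ, stopTime M Υ T ι = t ∧ Halts M Υ t ∧ (run M Υ t).SatSentence χ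

open Classical in
/-- The truth value of `θ_{Υ,χ,𝐭}` in `M`: `none` if it is undefined. -/
noncomputable def truthValue (Υ : Scheme L) (χ : (plus L).Sentence) (T : ℕ → ℕ∞) (ι : Mode) :
    Option Prop :=
  if Defined M Υ T ι then some (Holds M Υ χ T ι) else none

end Computation

/-! ### Random models -/

/-- A complete quantifier free 1-type `p(x)` over `A` that contains `x ≠ a` for all `a ∈ A`: a
choice, for each atomic formula `R(z₁, …, zₙ)` with `zᵢ ∈ A ∪ {x}` in which `x` occurs, of that
formula or of its negation. In the tuples below `none` stands for `x`. -/
def QFType (L : FirstOrder.Language.{u, v}) (A : Finset M) : Type (max v w) :=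
  (n : ℕ) → (R : L.Relations n) → {z : Fin n → Option A // ∃ i, z i = none} → Prop

/-- `b` realizes `p`. -/
def QFType.Realizes {L : FirstOrder.Language.{u, v}} [L.Structure M] {A : Finset M} (p : QFType L A)
    (b : M) : Prop :=
  b ∉ A ∧ ∀ (n : ℕ) (R : L.Relations n) (z : {z : Fin n → Option A // ∃ i, z i = none}),
    FirstOrder.Language.Structure.RelMap R (fun i => (z.1 i).elim b (fun a => (a : M))) ↔ p n R z

/-- `M` is an `(𝐬, k)`-random `τ`-model. -/
def IsRandom (L : FirstOrder.Language.{u, v}) (M : Type w) [L.Structure M] (S : ℕ → ℕ∞) (k : ℕ) : Prop :=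
  ∀ A : Finset M, A.card < k → ∀ p : QFType L A,
    S (Nat.card M) ≤ {b : M | p.Realizes b}.encard

end CPT

/-! The models are compared by a back-and-forth argument that is carried along the two computations.

At each time both stages consist of urelements and sets. The invariant `Sys` is a one-to-one
correspondence `E` between all sets of one stage and all sets of the other, preserving membership
and the predicates, such that whether a urelement belongs to a set depends only on the urelement's
own quantifier-free type. Sets therefore come with fixed partners, and membership puts no further
constraint on how urelements are matched. A finite matching of urelements only has to be a partial
isomorphism of `τ`-models, and randomness extends it as long as it is small (`Good.exists_forth`).
By `realize_iff_of_system` the two stages satisfy the same formulas of width at most `s` at matched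
tuples, so the target condition and `χ` have the same truth value in both.

The main point is that the invariant survives a step in which each `ψ_k` defines fewer sets than the
number of realizations of a type. Fix all urelements but one of a parameter tuple and let this one
vary over its type. By the pigeonhole principle two distinct values `y₁`, `y₂` define the same set.
Given `y₃`, `y₄` of the same type, `exists_amalgam` provides `y₅` such that `(y₁, y₂)` looks like
both `(y₃, y₅)` and `(y₄, y₅)`; so `y₃`, `y₅` and `y₄` define the same set (`defSet_subst_eq`).
Parameters can hence be moved, one at a time, to a position where they have no relation with a given
urelement `a`. Once they are there, membership of `a` in the defined set depends only on the type of
`a` (`mem_defSet_iff_of_corr`). So sets defined from matched parameters correspond, which gives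
`Sys.next`.

While a computation runs, each family has at most `T` members, and `T` is below the number of
realizations. Two running computations thus agree on the target condition, and the truth values can
differ only if one computation stops early. -/

namespace CPT

open FirstOrder.Language FirstOrder.Language.Structure

/-! ### Back-and-forth systems and formulas of bounded width -/

section System

variable {L : FirstOrder.Language.{u, v}}

theorem WidthLE.encard_le {α : Type} {s n : ℕ} {θ : L.BoundedFormula α n} (h : WidthLE s θ) :
    (freeVars θ).encard ≤ s := by
  cases θ with
  | falsum => simp [freeVars]
  | equal => exact h
  | rel => exact h
  | imp => exact h.1
  | all => exact h.1

/-- The pairs of values of the variables of `F` under two assignments. -/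
def valuePairs {A : Type w} {B : Type w'} {β : Type} (F : Set β) (f : β → A) (g : β → B) :
    Set (A × B) :=
  (fun i => (f i, g i)) '' F

theorem valuePairs_snoc_subset {A : Type w} {B : Type w'} {α : Type} {n : ℕ}
    (θ : L.BoundedFormula α (n + 1)) (v : α → A) (xs : Fin n → A) (v' : α → B) (xs' : Fin n → B)
    (a : A) (b : B) :
    valuePairs (freeVars θ) (Sum.elim v (Fin.snoc xs a : Fin (n + 1) → A))
      (Sum.elim v' (Fin.snoc xs' b : Fin (n + 1) → B)) ⊆
      {p | Sum.inr (Fin.last n) ∈ freeVars θ ∧ p = (a, b)} ∪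
        valuePairs (freeVars θ.all) (Sum.elim v xs) (Sum.elim v' xs') := by
  rintro _ ⟨i | i, hi, rfl⟩
  · exact Or.inr ⟨Sum.inl i, hi, rfl⟩
  · induction i using Fin.lastCases with
    | last => exact Or.inl ⟨hi, by simp⟩
    | cast i => exact Or.inr ⟨Sum.inr i, hi, by simp⟩

/-- The quantified variable takes one of the at most `s` places, which leaves room for one more pair
in the back-and-forth step. -/
theorem encard_freeVars_all_lt {α : Type} {s n : ℕ} {θ : L.BoundedFormula α (n + 1)}
    (h : WidthLE s θ) (hl : Sum.inr (Fin.last n) ∈ freeVars θ) : (freeVars θ.all).encard < s := by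
  have hinj : Function.Injective (Sum.map id Fin.castSucc : α ⊕ Fin n → α ⊕ Fin (n + 1)) :=
    Sum.map_injective.2 ⟨Function.injective_id, Fin.castSucc_injective n⟩
  have hsub : insert (Sum.inr (Fin.last n)) (Sum.map id Fin.castSucc '' freeVars θ.all) ⊆
      freeVars θ := by
    rintro _ (rfl | ⟨i, hi, rfl⟩)
    · exact hl
    · exact hi
  have hnot : Sum.inr (Fin.last n) ∉
      (Sum.map id Fin.castSucc : α ⊕ Fin n → α ⊕ Fin (n + 1)) '' freeVars θ.all := by
    rintro ⟨i | i, -, hi⟩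
    · simp at hi
    · simp only [Sum.map_inr, Sum.inr.injEq] at hi
      exact (Fin.castSucc_lt_last i).ne hi
  have h1 := (Set.encard_le_encard hsub).trans h.encard_le
  rw [Set.encard_insert_of_notMem hnot, hinj.encard_image] at h1
  have hfin : (freeVars θ.all).encard ≠ ⊤ := fun ht => by simp [ht] at h1
  exact (ENat.add_one_le_iff hfin).1 h1

/-- A family of partial correspondences with the back-and-forth property for fewer than `s` pairs
preserves the formulas whose subformulas have at most `s` free variables. -/
theorem realize_iff_of_system [L.IsRelational] {A : Type w} {B : Type w'} [L.Structure A]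
    [L.Structure B] [Nonempty A] [Nonempty B] {s : ℕ} (F : Set (A × B) → Prop)
    (mono : ∀ p q, p ⊆ q → F q → F p)
    (heq : ∀ p, F p → ∀ x ∈ p, ∀ y ∈ p, (x.1 = y.1 ↔ x.2 = y.2))
    (hrel : ∀ p, F p → ∀ (n : ℕ) (R : L.Relations n) (z : Fin n → A × B), (∀ i, z i ∈ p) →
      (RelMap R (fun i => (z i).1) ↔ RelMap R (fun i => (z i).2)))
    (forth : ∀ p, F p → p.encard < s → ∀ a, ∃ b, F (insert (a, b) p))
    (back : ∀ p, F p → p.encard < s → ∀ b, ∃ a, F (insert (a, b) p)) {α : Type} {n : ℕ}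
    (θ : L.BoundedFormula α n) (hθ : WidthLE s θ) (v : α → A) (xs : Fin n → A) (v' : α → B)
    (xs' : Fin n → B) (hF : F (valuePairs (freeVars θ) (Sum.elim v xs) (Sum.elim v' xs'))) :
    θ.Realize v xs ↔ θ.Realize v' xs' := by
  induction θ with
  | falsum => rfl
  | equal t₁ t₂ =>
    obtain ⟨i, rfl⟩ : ∃ x, t₁ = .var x := by
      cases t₁ with
      | var x => exact ⟨x, rfl⟩
      | func f _ => exact isEmptyElim f
    obtain ⟨j, rfl⟩ : ∃ x, t₂ = .var x := by
      cases t₂ with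
      | var x => exact ⟨x, rfl⟩
      | func f _ => exact isEmptyElim f
    exact heq _ hF _ ⟨i, Or.inl ⟨i, rfl, rfl⟩, rfl⟩ _ ⟨j, Or.inr ⟨j, rfl, rfl⟩, rfl⟩
  | rel R ts =>
    have hts : ∀ i, ∃ x, ts i = .var x := fun i => by
      cases ts i with
      | var x => exact ⟨x, rfl⟩
      | func f _ => exact isEmptyElim f
    choose x hx using hts
    have := hrel _ hF _ R (fun i => (Sum.elim v xs (x i), Sum.elim v' xs' (x i)))
      fun i => ⟨x i, ⟨i, hx i⟩, rfl⟩
    simpa [BoundedFormula.Realize, hx] using this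
  | imp θ₁ θ₂ ih₁ ih₂ =>
    have h₁ := ih₁ hθ.2.1 xs xs' (mono _ _ (Set.image_mono Set.subset_union_left) hF)
    have h₂ := ih₂ hθ.2.2 xs xs' (mono _ _ (Set.image_mono Set.subset_union_right) hF)
    simp only [BoundedFormula.Realize, h₁, h₂]
  | all θ ih =>
    have hsub := valuePairs_snoc_subset θ v xs v' xs'
    -- If the quantified variable does not occur free in `θ`, there may already be `s` pairs and no
    -- room to extend. In that case the new value is irrelevant, and `key` works with the old pairs.
    have hcard : Sum.inr (Fin.last _) ∈ freeVars θ →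
        (valuePairs (freeVars θ.all) (Sum.elim v xs) (Sum.elim v' xs')).encard < s := fun hl =>
      (Set.encard_image_le _ _).trans_lt (encard_freeVars_all_lt hθ.2 hl)
    have key : ∀ a b, (Sum.inr (Fin.last _) ∈ freeVars θ →
        F (insert (a, b) (valuePairs (freeVars θ.all) (Sum.elim v xs) (Sum.elim v' xs')))) →
        (θ.Realize v (Fin.snoc xs a) ↔ θ.Realize v' (Fin.snoc xs' b)) := by
      intro a b hab
      apply ih hθ.2
      by_cases hl : Sum.inr (Fin.last _) ∈ freeVars θ
      · refine mono _ _ ((hsub a b).trans ?_) (hab hl)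
        rintro p (⟨-, rfl⟩ | hp)
        · exact Set.mem_insert _ _
        · exact Set.mem_insert_of_mem _ hp
      · refine mono _ _ ((hsub a b).trans ?_) hF
        rintro p (⟨h, -⟩ | hp)
        · exact absurd h hl
        · exact hp
    have forth' : ∀ a, ∃ b, θ.Realize v (Fin.snoc xs a) ↔ θ.Realize v' (Fin.snoc xs' b) := by
      intro a
      by_cases hl : Sum.inr (Fin.last _) ∈ freeVars θ
      · obtain ⟨b, hb⟩ := forth _ hF (hcard hl) a
        exact ⟨b, key a b fun _ => hb⟩
      · exact ⟨Classical.arbitrary B, key a _ fun h => absurd h hl⟩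
    have back' : ∀ b, ∃ a, θ.Realize v (Fin.snoc xs a) ↔ θ.Realize v' (Fin.snoc xs' b) := by
      intro b
      by_cases hl : Sum.inr (Fin.last _) ∈ freeVars θ
      · obtain ⟨a, ha⟩ := back _ hF (hcard hl) b
        exact ⟨a, key a b fun _ => ha⟩
      · exact ⟨Classical.arbitrary A, key _ b fun h => absurd h hl⟩
    constructor
    · intro h b
      obtain ⟨a, ha⟩ := back' b
      exact ha.1 (h a)
    · intro h a
      obtain ⟨b, hb⟩ := forth' a
      exact hb.2 (h b)

/-- Formulas whose subformulas have no free variables have the same truth value in all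
structures. -/
theorem realize_iff_of_widthLE_zero [L.IsRelational] {A : Type w} {B : Type w'} [L.Structure A]
    [L.Structure B] [Nonempty A] [Nonempty B] (h0 : IsEmpty (L.Relations 0)) {α : Type} {n : ℕ}
    (θ : L.BoundedFormula α n) (hθ : WidthLE 0 θ) (v : α → A) (xs : Fin n → A) (v' : α → B)
    (xs' : Fin n → B) : θ.Realize v xs ↔ θ.Realize v' xs' := by
  refine realize_iff_of_system (s := 0) (fun p => p = ∅) ?_ ?_ ?_ ?_ ?_ θ hθ v xs v' xs' ?_
  · rintro p q hpq rfl
    exact Set.subset_empty_iff.1 hpq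
  · rintro p rfl x hx
    exact absurd hx (Set.notMem_empty x)
  · rintro p rfl (_ | n) R z hz
    · exact isEmptyElim R
    · exact absurd (hz 0) (Set.notMem_empty _)
  -- Both extension properties are vacuous, since no set has fewer than `0` elements.
  · intro p _ hp
    simp at hp
  · intro p _ hp
    simp at hp
  · have : freeVars θ = ∅ := by simpa using hθ.encard_le
    simp [valuePairs, this]

end System

/-! ### Partial isomorphisms -/

section PIso

variable (L : FirstOrder.Language.{u, v}) {M : Type w} {M' : Type w'} [L.Structure M]
  [L.Structure M']

/-- A set of pairs is the graph of a partial isomorphism. -/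
def PIso (p : Set (M × M')) : Prop :=
  (∀ x ∈ p, ∀ y ∈ p, (x.1 = y.1 ↔ x.2 = y.2)) ∧
    ∀ (n : ℕ) (R : L.Relations n) (z : Fin n → M × M'), (∀ i, z i ∈ p) →
      (RelMap R (fun i => (z i).1) ↔ RelMap R (fun i => (z i).2))

variable {L}

theorem PIso.mono {p q : Set (M × M')} (hq : PIso L q) (h : p ⊆ q) : PIso L p :=
  ⟨fun x hx y hy => hq.1 x (h hx) y (h hy), fun n R z hz => hq.2 n R z fun i => h (hz i)⟩

theorem PIso.symm {p : Set (M × M')} (hp : PIso L p) : PIso L (Prod.swap ⁻¹' p) :=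
  ⟨fun _ hx _ hy => (hp.1 _ hx _ hy).symm, fun n R z hz =>
    (hp.2 n R (fun i => (z i).swap) hz).symm⟩

theorem PIso.empty [IsEmpty (L.Relations 0)] : PIso L (∅ : Set (M × M')) := by
  refine ⟨fun x hx => absurd hx (Set.notMem_empty x), ?_⟩
  rintro (_ | n) R z hz
  · exact isEmptyElim R
  · exact absurd (hz 0) (Set.notMem_empty _)

theorem PIso.comp {M'' : Type*} [L.Structure M''] {p : Set (M × M')} {q : Set (M' × M'')}
    (hp : PIso L p) (hq : PIso L q) : PIso L {x : M × M'' | ∃ b, (x.1, b) ∈ p ∧ (b, x.2) ∈ q} := by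
  refine ⟨?_, ?_⟩
  · rintro ⟨a, c⟩ ⟨b, h1, h2⟩ ⟨a', c'⟩ ⟨b', h1', h2'⟩
    exact (hp.1 _ h1 _ h1').trans (hq.1 _ h2 _ h2')
  · intro n R z hz
    choose b h1 h2 using hz
    exact (hp.2 n R (fun i => ((z i).1, b i)) h1).trans (hq.2 n R (fun i => (b i, (z i).2)) h2)

theorem PIso.of_eq {p : Set (M × M)} (h : ∀ x ∈ p, x.1 = x.2) : PIso L p := by
  refine ⟨fun x hx y hy => by rw [h x hx, h y hy], fun n R z hz => ?_⟩
  rw [show (fun i => (z i).1) = fun i => (z i).2 from funext fun i => h _ (hz i)]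

/-- An element `y` whose type over `D` is the type of `e` pulled back along `g` extends a partial
isomorphism `p` which is inverted by `g`. -/
theorem PIso.insert_of_pullback {p : Set (M × M')} (hp : PIso L p) {D : Set M'} {g : M' → M}
    {e : M} {y : M'} (hy : y ∉ D) (hD : ∀ x ∈ p, x.2 ∈ D) (hg : ∀ x ∈ p, g x.2 = x.1)
    (he : ∀ x ∈ p, x.1 ≠ e)
    (hR : ∀ (n : ℕ) (R : L.Relations n) (z : Fin n → Option M'), (∃ i, z i = none) →
      (∀ i d, z i = some d → ∃ x ∈ p, x.2 = d) →
      (RelMap R (fun i => (z i).elim y id) ↔ RelMap R (fun i => (z i).elim e g))) :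
    PIso L (insert (e, y) p) := by
  classical
  refine ⟨?_, ?_⟩
  · have hy' : ∀ x ∈ p, x.2 ≠ y := fun x hx h => hy (h ▸ hD x hx)
    rintro x (rfl | hx) x' (rfl | hx')
    · simp
    · simp [(he x' hx').symm, (hy' x' hx').symm]
    · simp [he x hx, hy' x hx]
    · exact hp.1 x hx x' hx'
  · intro n R z hz
    by_cases hall : ∀ i, z i ∈ p
    · exact hp.2 n R z hall
    push Not at hall
    obtain ⟨i₀, hi₀⟩ := hall
    have hz' : ∀ i, z i ∉ p → z i = (e, y) := fun i hi => (hz i).resolve_right hi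
    -- Entries of `z` outside `p` all equal `(e, y)`; they become the variable `none`.
    have := hR n R (fun i => if z i ∈ p then some (z i).2 else none) ⟨i₀, by simp [hi₀]⟩ ?_
    · refine Iff.trans ?_ (this.symm.trans ?_)
      · apply iff_of_eq
        congr 1
        funext i
        by_cases hi : z i ∈ p
        · simp [hi, hg _ hi]
        · rw [if_neg hi, hz' i hi]
          rfl
      · apply iff_of_eq
        congr 1
        funext i
        by_cases hi : z i ∈ p
        · simp [hi]
        · rw [if_neg hi, hz' i hi]
          rfl
    · intro i d hd
      by_cases hi : z i ∈ p
      · simp only [hi, if_true, Option.some.injEq] at hd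
        exact ⟨z i, hi, hd⟩
      · simp [hi] at hd

/-- In a random model the elements outside a small set with prescribed relations to it are
numerous. -/
theorem IsRandom.le_encard [Finite M] {S : ℕ → ℕ∞} {k : ℕ} (h : IsRandom L M S k) (D : Set M)
    (hD : D.ncard < k) (Q : (n : ℕ) → L.Relations n → (Fin n → Option M) → Prop) :
    S (Nat.card M) ≤ {y : M | y ∉ D ∧ ∀ (n : ℕ) (R : L.Relations n) (z : Fin n → Option M),
      (∃ i, z i = none) → (∀ i d, z i = some d → d ∈ D) →
        (RelMap R (fun i => (z i).elim y id) ↔ Q n R z)}.encard := by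
  classical
  have hfin : D.Finite := D.toFinite
  refine (h hfin.toFinset (by rwa [← Set.ncard_eq_toFinset_card D hfin])
    (fun n R z => Q n R fun i => (z.1 i).map (↑))).trans (Set.encard_le_encard ?_)
  rintro y ⟨hy, hR⟩
  refine ⟨by simpa using hy, fun n R z hn hz => ?_⟩
  have hz' : ∀ i, ∃ o : Option hfin.toFinset, o.map (↑) = z i := by
    intro i
    cases hi : z i with
    | none => exact ⟨none, rfl⟩
    | some d => exact ⟨some ⟨d, hfin.mem_toFinset.2 (hz i d hi)⟩, rfl⟩
  choose z' hz' using hz'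
  obtain rfl : (fun i => (z' i).map (↑)) = z := funext hz'
  obtain ⟨i, hi⟩ := hn
  have := hR n R ⟨z', i, by simpa using hi⟩
  refine Iff.trans ?_ this
  simp only [Option.elim_map]
  rfl

theorem IsRandom.exists_realize [Finite M] {S : ℕ → ℕ∞} {k : ℕ} (h : IsRandom L M S k)
    (hS : 0 < S (Nat.card M)) (D : Set M) (hD : D.ncard < k)
    (Q : (n : ℕ) → L.Relations n → (Fin n → Option M) → Prop) :
    ∃ y ∉ D, ∀ (n : ℕ) (R : L.Relations n) (z : Fin n → Option M),
      (∃ i, z i = none) → (∀ i d, z i = some d → d ∈ D) →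
        (RelMap R (fun i => (z i).elim y id) ↔ Q n R z) :=
  Set.encard_pos.1 (hS.trans_le (h.le_encard D hD Q))

/-- The type of a new `a` over the domain is carried over to the range by the inverse `g` of `p` and
realized there outside the range. -/
theorem PIso.exists_forth [Finite M] [Finite M'] {S : ℕ → ℕ∞} {k : ℕ} (h : IsRandom L M' S k)
    (hS : 0 < S (Nat.card M')) {p : Set (M × M')} (hp : PIso L p) (hk : p.ncard < k) (a : M) :
    ∃ b, PIso L (insert (a, b) p) := by
  classical
  by_cases ha : ∃ x ∈ p, x.1 = a
  · obtain ⟨x, hx, rfl⟩ := ha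
    exact ⟨x.2, by rwa [Set.insert_eq_of_mem (by simpa using hx)]⟩
  push Not at ha
  -- The default value `a` is harmless: `g` is only evaluated on the range of `p`.
  let g : M' → M := fun d => if hd : ∃ x ∈ p, x.2 = d then hd.choose.1 else a
  have hg : ∀ x ∈ p, g x.2 = x.1 := by
    intro x hx
    have hd : ∃ x' ∈ p, x'.2 = x.2 := ⟨x, hx, rfl⟩
    simp only [g, dif_pos hd]
    exact (hp.1 _ hd.choose_spec.1 _ hx).2 hd.choose_spec.2
  obtain ⟨y, hy, hR⟩ := h.exists_realize hS (Prod.snd '' p)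
    ((Set.ncard_image_le p.toFinite).trans_lt hk) (fun n R z => RelMap R fun i => (z i).elim a g)
  exact ⟨y, hp.insert_of_pullback hy (fun x hx => ⟨x, hx, rfl⟩) hg ha hR⟩

end PIso

/-! ### Elements of `V_t[M]` -/

section Rank

variable {M : Type w}

theorem ur_injective : ∀ t : ℕ, Function.Injective (ur t : M → V M t)
  | 0 => fun _ _ h => h
  | _ + 1 => Sum.inl_injective

@[simp]
theorem lift_ur : ∀ (t : ℕ) (a : M), lift t (ur t a) = ur (t + 1) a
  | 0, _ => rfl
  | _ + 1, _ => rfl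

theorem ofSet_injective {t : ℕ} : Function.Injective (ofSet : Set (V M t) → V M (t + 1)) :=
  Sum.inr_injective

theorem ofSet_ne_ur {t : ℕ} (X : Set (V M t)) (a : M) : ofSet X ≠ ur (t + 1) a :=
  Sum.inr_ne_inl

theorem lift_injective : ∀ t : ℕ, Function.Injective (lift t : V M t → V M (t + 1))
  | 0 => Sum.inl_injective
  | t + 1 => by
    rintro (a | X) (b | Y) h
    · exact congrArg Sum.inl (Sum.inl_injective h)
    · exact (Sum.inl_ne_inr h).elim
    · exact (Sum.inr_ne_inl h).elim
    · exact congrArg Sum.inr ((lift_injective t).image_injective (Sum.inr_injective h))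

theorem mem_ofSet {t : ℕ} {x : V M (t + 1)} {X : Set (V M t)} :
    mem (t + 1) x (ofSet X) ↔ ∃ z ∈ X, lift t z = x := by
  constructor
  · rintro ⟨Y, hY, h⟩
    rwa [ofSet_injective hY]
  · exact fun h => ⟨X, rfl, h⟩

theorem lift_mem_ofSet {t : ℕ} {z : V M t} {X : Set (V M t)} :
    mem (t + 1) (lift t z) (ofSet X) ↔ z ∈ X := by
  rw [mem_ofSet]
  exact ⟨fun ⟨z', hz', h⟩ => lift_injective t h ▸ hz', fun h => ⟨z, h, rfl⟩⟩

theorem not_mem_ur : ∀ (t : ℕ) (x : V M t) (a : M), ¬ mem t x (ur t a)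
  | 0, _, _ => id
  | _ + 1, _, a => fun ⟨X, hX, _⟩ => ofSet_ne_ur X a hX.symm

/-- A set is included in the next level as the set of its elements. -/
theorem lift_eq_ofSet : ∀ (t : ℕ) (u : V M t), (∀ a, u ≠ ur t a) →
    lift t u = ofSet {z | mem t z u}
  | 0, u, h => (h u rfl).elim
  | _ + 1, Sum.inl a, h => (h a rfl).elim
  | t + 1, Sum.inr U, _ => by
    refine congrArg Sum.inr ?_
    ext z
    exact mem_ofSet.symm

end Rank

/-! ### Regular stages -/

section Regular

variable {M : Type w}

/-- The urelements belong to the stage, the stage is transitive, and its predicates do not hold of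
urelements. -/
structure Stage.Regular {m t : ℕ} (S : Stage M m t) : Prop where
  ur_mem : ∀ a, ur t a ∈ S.N
  trans : ∀ x ∈ S.N, ∀ z, mem t z x → z ∈ S.N
  not_pred : ∀ a ℓ, ur t a ∉ S.P ℓ

variable {L : FirstOrder.Language.{u, v}} [L.IsRelational] [L.Structure M] {Υ : Scheme L}

theorem Stage.family_subset {t : ℕ} {S : Stage M Υ.m₁ t} {k : Fin Υ.m₀} {X : Set (V M t)}
    (h : X ∈ S.family Υ k) : X ⊆ S.N := by
  obtain ⟨b, rfl⟩ := h
  exact fun a ha => ha.1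

theorem Stage.c_subset {t : ℕ} (S : Stage M Υ.m₁ t) (ℓ : Fin Υ.m₁) : S.c Υ ℓ ⊆ S.N :=
  fun _ ha => ha.1

/-- A set kept from the old stage has its members there by transitivity; a new one is a subset of
the stage by construction. -/
theorem Stage.Regular.subset_of_ofSet_mem {t : ℕ} {S : Stage M Υ.m₁ t} (hS : S.Regular)
    {X : Set (V M t)} (h : ofSet X ∈ S.nextN Υ) : X ⊆ S.N := by
  rcases h with ⟨u, hu, huX⟩ | ⟨Y, hY, hYX⟩
  · have hur : ∀ a, u ≠ ur t a := by
      rintro a rfl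
      rw [lift_ur] at huX
      exact ofSet_ne_ur X a huX.symm
    rw [lift_eq_ofSet t u hur] at huX
    rw [← ofSet_injective huX]
    exact fun z hz => hS.trans u hu z hz
  · rw [← ofSet_injective hYX]
    obtain ⟨k, hk⟩ := Set.mem_iUnion.1 hY
    exact Stage.family_subset hk

theorem Stage.Regular.next {t : ℕ} {S : Stage M Υ.m₁ t} (hS : S.Regular) :
    (S.next Υ).Regular where
  ur_mem a := Or.inl ⟨ur t a, hS.ur_mem a, lift_ur t a⟩
  trans := by
    rintro x hx z ⟨X, rfl, y, hy, rfl⟩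
    exact Or.inl ⟨y, hS.subset_of_ofSet_mem hx hy, rfl⟩
  not_pred a ℓ h := ofSet_ne_ur _ a h.2.symm

variable (M Υ) in
theorem run_regular : ∀ t : ℕ, (run M Υ t).Regular
  | 0 => ⟨fun _ => Set.mem_univ _, fun _ _ _ _ => Set.mem_univ _, fun _ _ h => h⟩
  | t + 1 => (run_regular t).next

end Regular

/-! ### Correspondences between stages -/

section Sys

variable (L : FirstOrder.Language.{u, v}) {M : Type w} {M' : Type w'} [L.Structure M]
  [L.Structure M'] {m t : ℕ}

/-- Two elements correspond: they are corresponding sets, or urelements of the same type. -/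
def Corr (E : V M t → V M' t → Prop) (x : V M t) (y : V M' t) : Prop :=
  E x y ∨ ∃ a b, x = ur t a ∧ y = ur t b ∧ PIso L {(a, b)}

/-- `E` is a correspondence between all the sets of `S` and of `S'` which preserves membership
and the predicates, and under which sets contain the same types of urelements. -/
structure Sys (S : Stage M m t) (S' : Stage M' m t) (E : V M t → V M' t → Prop) : Prop where
  left_mem : ∀ x y, E x y → x ∈ S.N
  right_mem : ∀ x y, E x y → y ∈ S'.N
  left_ne : ∀ x y, E x y → ∀ a, x ≠ ur t a
  right_ne : ∀ x y, E x y → ∀ a, y ≠ ur t a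
  left_total : ∀ x ∈ S.N, (∃ a, x = ur t a) ∨ ∃ y, E x y
  right_total : ∀ y ∈ S'.N, (∃ a, y = ur t a) ∨ ∃ x, E x y
  inj : ∀ x y x' y', E x y → E x' y' → (x = x' ↔ y = y')
  mem_iff : ∀ x y x' y', Corr L E x y → E x' y' → (mem t x x' ↔ mem t y y')
  pred_iff : ∀ x y, E x y → ∀ ℓ, (x ∈ S.P ℓ ↔ y ∈ S'.P ℓ)

variable {L}

theorem PIso.symm_singleton {a : M} {b : M'} (h : PIso L {(a, b)}) : PIso L {(b, a)} := by
  refine h.symm.mono ?_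
  rintro _ rfl
  rfl

theorem Corr.symm {E : V M t → V M' t → Prop} {x : V M t} {y : V M' t} (h : Corr L E x y) :
    Corr L (flip E) y x := by
  rcases h with h | ⟨a, b, rfl, rfl, h⟩
  · exact Or.inl h
  · exact Or.inr ⟨b, a, rfl, rfl, h.symm_singleton⟩

theorem Sys.symm {S : Stage M m t} {S' : Stage M' m t} {E : V M t → V M' t → Prop}
    (h : Sys L S S' E) : Sys L S' S (flip E) where
  left_mem x y := h.right_mem y x
  right_mem x y := h.left_mem y x
  left_ne x y := h.right_ne y x
  right_ne x y := h.left_ne y x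
  left_total := h.right_total
  right_total := h.left_total
  inj x y x' y' hx hx' := (h.inj y x y' x' hx hx').symm
  mem_iff x y x' y' hx hx' := (h.mem_iff y x y' x' hx.symm hx').symm
  pred_iff x y hx ℓ := (h.pred_iff y x hx ℓ).symm

/-- The pairs of urelements in a set of pairs. -/
def urPairs (q : Set (V M t × V M' t)) : Set (M × M') := {p | (ur t p.1, ur t p.2) ∈ q}

theorem encard_urPairs_le (q : Set (V M t × V M' t)) : (urPairs q).encard ≤ q.encard := by
  have hinj : Function.Injective (fun p : M × M' => (ur t p.1, ur t p.2)) := by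
    rintro ⟨a, b⟩ ⟨a', b'⟩ h
    simp only [Prod.mk.injEq] at h
    exact Prod.ext (ur_injective t h.1) (ur_injective t h.2)
  rw [← hinj.encard_image]
  refine Set.encard_le_encard ?_
  rintro _ ⟨p, hp, rfl⟩
  exact hp

theorem urPairs_insert_ur (q : Set (V M t × V M' t)) (a : M) (b : M') :
    urPairs (insert (ur t a, ur t b) q) = insert (a, b) (urPairs q) := by
  ext ⟨a', b'⟩
  simp [urPairs, (ur_injective t).eq_iff]

theorem urPairs_insert_of_ne (q : Set (V M t × V M' t)) {x : V M t} {y : V M' t}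
    (h : ∀ a, x ≠ ur t a) : urPairs (insert (x, y) q) = urPairs q := by
  ext ⟨a', b'⟩
  have := (h a').symm
  simp [urPairs, this]

variable (L) in
/-- A set of pairs preserves the sort (corresponding sets or urelements) and the atomic formulas
of `τ`. -/
def Good (E : V M t → V M' t → Prop) (q : Set (V M t × V M' t)) : Prop :=
  (∀ x ∈ q, (∃ a b, x = (ur t a, ur t b)) ∨ E x.1 x.2) ∧ PIso L (urPairs q)

theorem Good.mono {E : V M t → V M' t → Prop} {q r : Set (V M t × V M' t)} (hr : Good L E r)
    (h : q ⊆ r) : Good L E q :=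
  ⟨fun x hx => hr.1 x (h hx), hr.2.mono fun _ hp => h hp⟩

theorem Good.symm {E : V M t → V M' t → Prop} {q : Set (V M t × V M' t)} (hq : Good L E q) :
    Good L (flip E) (Prod.swap ⁻¹' q) := by
  refine ⟨fun x hx => ?_, hq.2.symm⟩
  rcases hq.1 _ hx with ⟨a, b, h⟩ | h
  · exact Or.inl ⟨b, a, by rw [← Prod.swap_swap x, h]; rfl⟩
  · exact Or.inr h

theorem Good.insert_of_rel {S : Stage M m t} {S' : Stage M' m t} {E : V M t → V M' t → Prop}
    (hE : Sys L S S' E) {q : Set (V M t × V M' t)} (hq : Good L E q) {x : V M t} {y : V M' t}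
    (h : E x y) : Good L E (insert (x, y) q) := by
  refine ⟨?_, by rw [urPairs_insert_of_ne q (hE.left_ne x y h)]; exact hq.2⟩
  rintro _ (rfl | hz)
  · exact Or.inr h
  · exact hq.1 _ hz

theorem Good.insert_ur {E : V M t → V M' t → Prop} {q : Set (V M t × V M' t)} (hq : Good L E q)
    {a : M} {b : M'} (h : PIso L (insert (a, b) (urPairs q))) :
    Good L E (insert (ur t a, ur t b) q) := by
  refine ⟨?_, by rwa [urPairs_insert_ur]⟩
  rintro _ (rfl | hz)
  · exact Or.inl ⟨a, b, rfl⟩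
  · exact hq.1 _ hz

/-- A set is sent to its fixed partner at no cost, so only urelements use up randomness. This is why
the bound concerns `urPairs q` and not `q`, which may contain all the sets. -/
theorem Good.exists_forth [Finite M] [Finite M'] {S : Stage M m t} {S' : Stage M' m t}
    {E : V M t → V M' t → Prop} (hE : Sys L S S' E) (hS' : S'.Regular) {R : ℕ → ℕ∞} {k : ℕ}
    (hM' : IsRandom L M' R k) (hR : 0 < R (Nat.card M')) {q : Set (V M t × V M' t)}
    (hq : Good L E q) (hk : (urPairs q).ncard < k) {x : V M t} (hx : x ∈ S.N) :
    ∃ y ∈ S'.N, Good L E (insert (x, y) q) := by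
  rcases hE.left_total x hx with ⟨a, rfl⟩ | ⟨y, hy⟩
  · obtain ⟨b, hb⟩ := hq.2.exists_forth hM' hR hk a
    exact ⟨ur t b, hS'.ur_mem b, hq.insert_ur hb⟩
  · exact ⟨y, hE.right_mem x y hy, hq.insert_of_rel hE hy⟩

theorem Good.exists_back [Finite M] [Finite M'] {S : Stage M m t} {S' : Stage M' m t}
    {E : V M t → V M' t → Prop} (hE : Sys L S S' E) (hS : S.Regular) {R : ℕ → ℕ∞} {k : ℕ}
    (hM : IsRandom L M R k) (hR : 0 < R (Nat.card M)) {q : Set (V M t × V M' t)}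
    (hq : Good L E q) (hk : (urPairs q).ncard < k) {y : V M' t} (hy : y ∈ S'.N) :
    ∃ x ∈ S.N, Good L E (insert (x, y) q) := by
  have hk' : (urPairs (Prod.swap ⁻¹' q)).ncard < k := by
    have : urPairs (Prod.swap ⁻¹' q) = Prod.swap '' urPairs q := by
      ext ⟨a, b⟩
      simp [urPairs]
    rw [this]
    exact (Set.ncard_image_le (urPairs q).toFinite).trans_lt hk
  obtain ⟨x, hx, h⟩ := Good.exists_forth hE.symm hS hM hR hq.symm hk' hy
  refine ⟨x, hx, ?_⟩
  have := h.symm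
  refine this.mono ?_
  rintro p (rfl | hp)
  · exact Or.inl rfl
  · exact Or.inr hp

theorem Good.eq_iff {S : Stage M m t} {S' : Stage M' m t} {E : V M t → V M' t → Prop}
    (hE : Sys L S S' E) {q : Set (V M t × V M' t)} (hq : Good L E q) {x y : V M t × V M' t}
    (hx : x ∈ q) (hy : y ∈ q) : x.1 = y.1 ↔ x.2 = y.2 := by
  rcases hq.1 x hx with ⟨a, b, rfl⟩ | hxE <;> rcases hq.1 y hy with ⟨a', b', rfl⟩ | hyE
  · exact ((ur_injective t).eq_iff.trans (hq.2.1 (a, b) hx (a', b') hy)).trans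
      (ur_injective t).eq_iff.symm
  · exact iff_of_false (hE.left_ne _ _ hyE a).symm (hE.right_ne _ _ hyE b).symm
  · exact iff_of_false (hE.left_ne _ _ hxE a') (hE.right_ne _ _ hxE b')
  · exact hE.inj _ _ _ _ hxE hyE

theorem Good.corr {E : V M t → V M' t → Prop}
    {q : Set (V M t × V M' t)} (hq : Good L E q) {x : V M t × V M' t}
    (hx : x ∈ q) : Corr L E x.1 x.2 := by
  rcases hq.1 x hx with ⟨a, b, rfl⟩ | hxE
  · refine Or.inr ⟨a, b, rfl, rfl, hq.2.mono ?_⟩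
    rintro _ rfl
    exact hx
  · exact Or.inl hxE

/-- Urelements have no members, and a set sees only the type of each single urelement. Hence
membership does not interfere with the choice of urelements in the back-and-forth. -/
theorem Good.mem_iff {S : Stage M m t} {S' : Stage M' m t} {E : V M t → V M' t → Prop}
    (hE : Sys L S S' E) {q : Set (V M t × V M' t)} (hq : Good L E q) {x y : V M t × V M' t}
    (hx : x ∈ q) (hy : y ∈ q) : mem t x.1 y.1 ↔ mem t x.2 y.2 := by
  rcases hq.1 y hy with ⟨a, b, rfl⟩ | hyE
  · exact iff_of_false (not_mem_ur t _ a) (not_mem_ur t _ b)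
  · exact hE.mem_iff _ _ _ _ (hq.corr hx) hyE

theorem Good.relMap_iff_aux {S : Stage M m t} {S' : Stage M' m t} {E : V M t → V M' t → Prop}
    (hE : Sys L S S' E) {q : Set (V M t × V M' t)} (hq : Good L E q) {n : ℕ} (R : L.Relations n)
    (z : Fin n → V M t × V M' t) (hz : ∀ i, z i ∈ q)
    (h : ∃ a : Fin n → M, (∀ i, (z i).1 = ur t (a i)) ∧ RelMap R a) :
    ∃ a : Fin n → M', (∀ i, (z i).2 = ur t (a i)) ∧ RelMap R a := by
  obtain ⟨a, ha, hR⟩ := h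
  have : ∀ i, ∃ b, z i = (ur t (a i), ur t b) := by
    intro i
    rcases hq.1 _ (hz i) with ⟨a', b, h⟩ | h
    · have h1 := ha i
      rw [h] at h1
      exact ⟨b, by rw [h, ← ur_injective t h1]⟩
    · exact absurd (ha i) (hE.left_ne _ _ h _)
  choose b hb using this
  refine ⟨b, fun i => by rw [hb i], ?_⟩
  refine (hq.2.2 n R (fun i => (a i, b i)) fun i => ?_).1 hR
  show (ur t (a i), ur t (b i)) ∈ q
  rw [← hb i]
  exact hz i

theorem Good.relMap_iff {S : Stage M m t} {S' : Stage M' m t} {E : V M t → V M' t → Prop}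
    (hE : Sys L S S' E) {q : Set (V M t × V M' t)} (hq : Good L E q) {n : ℕ} (R : L.Relations n)
    (z : Fin n → V M t × V M' t) (hz : ∀ i, z i ∈ q) :
    (∃ a : Fin n → M, (∀ i, (z i).1 = ur t (a i)) ∧ RelMap R a) ↔
    ∃ a : Fin n → M', (∀ i, (z i).2 = ur t (a i)) ∧ RelMap R a :=
  ⟨hq.relMap_iff_aux hE R z hz, hq.symm.relMap_iff_aux hE.symm R (fun i => (z i).swap) hz⟩

theorem Good.pred_iff {S : Stage M m t} {S' : Stage M' m t} {E : V M t → V M' t → Prop}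
    (hE : Sys L S S' E) (hS : S.Regular) (hS' : S'.Regular) {q : Set (V M t × V M' t)}
    (hq : Good L E q) {x : V M t × V M' t} (hx : x ∈ q) (ℓ : Fin m) :
    x.1 ∈ S.P ℓ ↔ x.2 ∈ S'.P ℓ := by
  rcases hq.1 x hx with ⟨a, b, rfl⟩ | hxE
  · exact iff_of_false (hS.not_pred a ℓ) (hS'.not_pred b ℓ)
  · exact hE.pred_iff _ _ hxE ℓ

/-- Corresponding assignments satisfy the same formulas of bounded width. -/
theorem Good.realize_iff [Finite M] [Finite M'] [Nonempty M] [Nonempty M'] {S : Stage M m t}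
    {S' : Stage M' m t} {E : V M t → V M' t → Prop} (hE : Sys L S S' E) (hS : S.Regular)
    (hS' : S'.Regular) {R R' : ℕ → ℕ∞} {k s : ℕ} (hM : IsRandom L M R k)
    (hR : 0 < R (Nat.card M)) (hM' : IsRandom L M' R' k) (hR' : 0 < R' (Nat.card M'))
    (hsk : s ≤ k) {L' : FirstOrder.Language.{u, v}} [L'.IsRelational] [L'.Structure S.N]
    [L'.Structure S'.N] (hrel : ∀ q, Good L E q → ∀ (n : ℕ) (R : L'.Relations n)
      (z : Fin n → S.N × S'.N), (∀ i, (((z i).1 : V M t), ((z i).2 : V M' t)) ∈ q) →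
      (RelMap R (fun i => (z i).1) ↔ RelMap R (fun i => (z i).2)))
    {α : Type} (θ : L'.Formula α) (hθ : WidthLE s θ) (v : α → S.N)
    (v' : α → S'.N) (h : Good L E (Set.range fun i => ((v i : V M t), (v' i : V M' t)))) :
    θ.Realize v ↔ θ.Realize v' := by
  have : Nonempty S.N := ⟨⟨_, hS.ur_mem (Classical.arbitrary M)⟩⟩
  have : Nonempty S'.N := ⟨⟨_, hS'.ur_mem (Classical.arbitrary M')⟩⟩
  let f : S.N × S'.N → V M t × V M' t := Prod.map (↑) (↑)
  have hk : ∀ p : Set (S.N × S'.N), p.encard < s → (urPairs (f '' p)).ncard < k := by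
    intro p hp
    have h1 : (urPairs (f '' p)).encard < (s : ℕ∞) :=
      ((encard_urPairs_le _).trans (Set.encard_image_le _ _)).trans_lt hp
    rw [← Set.Finite.cast_ncard_eq (urPairs (f '' p)).toFinite] at h1
    exact (by exact_mod_cast h1 : (urPairs (f '' p)).ncard < s).trans_le hsk
  refine realize_iff_of_system (s := s) (fun p => Good L E (f '' p)) ?_ ?_ ?_ ?_ ?_ θ hθ v default
    v' default (h.mono ?_)
  · exact fun p q hpq hq => hq.mono (Set.image_mono hpq)
  · intro p hp x hx y hy
    have := hp.eq_iff hE (Set.mem_image_of_mem f hx) (Set.mem_image_of_mem f hy)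
    exact (Subtype.ext_iff.trans this).trans Subtype.ext_iff.symm
  · exact fun p hp n R₀ z hz => hrel _ hp n R₀ z fun i => Set.mem_image_of_mem f (hz i)
  · intro p hp hps a
    obtain ⟨b, hb, h⟩ := hp.exists_forth hE hS' hM' hR' (hk p hps) a.2
    exact ⟨⟨b, hb⟩, by rw [Set.image_insert_eq]; exact h⟩
  · intro p hp hps b
    obtain ⟨a, ha, h⟩ := hp.exists_back hE hS hM hR (hk p hps) b.2
    exact ⟨⟨a, ha⟩, by rw [Set.image_insert_eq]; exact h⟩
  · rintro _ ⟨_, ⟨i | i, -, rfl⟩, rfl⟩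
    · exact ⟨i, rfl⟩
    · exact i.elim0

theorem Good.relMap_plus_iff [L.IsRelational] {S : Stage M m t} {S' : Stage M' m t}
    {E : V M t → V M' t → Prop} (hE : Sys L S S' E) {q : Set (V M t × V M' t)} (hq : Good L E q)
    (n : ℕ) (R : (plus L).Relations n) (z : Fin n → S.N × S'.N)
    (hz : ∀ i, (((z i).1 : V M t), ((z i).2 : V M' t)) ∈ q) :
    RelMap R (fun i => (z i).1) ↔ RelMap R (fun i => (z i).2) := by
  rcases R with R | R
  · exact hq.relMap_iff hE R (fun i => (((z i).1 : V M t), ((z i).2 : V M' t))) hz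
  · cases R
    exact hq.mem_iff hE (hz 0) (hz 1)

theorem Good.sat_iff [L.IsRelational] [Finite M] [Finite M'] [Nonempty M] [Nonempty M']
    {S : Stage M m t}
    {S' : Stage M' m t} {E : V M t → V M' t → Prop} (hE : Sys L S S' E) (hS : S.Regular)
    (hS' : S'.Regular) {R R' : ℕ → ℕ∞} {k s : ℕ} (hM : IsRandom L M R k)
    (hR : 0 < R (Nat.card M)) (hM' : IsRandom L M' R' k) (hR' : 0 < R' (Nat.card M'))
    (hsk : s ≤ k) {α : Type} (θ : (plusDyn L m).Formula α) (hθ : WidthLE s θ) (v : α → S.N)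
    (v' : α → S'.N) (h : Good L E (Set.range fun i => ((v i : V M t), (v' i : V M' t)))) :
    S.Sat θ v ↔ S'.Sat θ v' := by
  let _ := dynStructure S.N S.P
  let _ := dynStructure S'.N S'.P
  refine Good.realize_iff hE hS hS' hM hR hM' hR' hsk (fun q hq n R₀ z hz => ?_) θ hθ v v' h
  rcases R₀ with R₀ | R₀
  · exact hq.relMap_plus_iff hE n R₀ z hz
  · obtain ⟨ℓ⟩ := R₀
    exact hq.pred_iff hE hS hS' (hz 0) ℓ

theorem Sys.satSentence_iff [L.IsRelational] [IsEmpty (L.Relations 0)] [Finite M] [Finite M']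
    [Nonempty M] [Nonempty M']
    {S : Stage M m t} {S' : Stage M' m t} {E : V M t → V M' t → Prop} (hE : Sys L S S' E)
    (hS : S.Regular) (hS' : S'.Regular) {R R' : ℕ → ℕ∞} {k s : ℕ} (hM : IsRandom L M R k)
    (hR : 0 < R (Nat.card M)) (hM' : IsRandom L M' R' k) (hR' : 0 < R' (Nat.card M'))
    (hsk : s ≤ k) (χ : (plus L).Sentence) (hχ : WidthLE s χ) :
    S.SatSentence χ ↔ S'.SatSentence χ := by
  refine Good.realize_iff hE hS hS' hM hR hM' hR' hsk
    (fun q hq n R₀ z hz => hq.relMap_plus_iff hE n R₀ z hz) χ hχ default default ⟨?_, ?_⟩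
  · rintro _ ⟨i, -⟩
    exact i.elim
  · refine PIso.empty.mono ?_
    rintro _ ⟨i, -⟩
    exact i.elim

end Sys

/-! ### Exchange of parameters -/

section Exchange

variable {L : FirstOrder.Language.{u, v}} {M : Type w} {M' : Type w'} [L.Structure M]
  [L.Structure M'] {m t r : ℕ}

/-- The identity correspondence on the sets of a stage. -/
def Diag (S : Stage M m t) (x y : V M t) : Prop :=
  x = y ∧ x ∈ S.N ∧ ∀ a, x ≠ ur t a

theorem PIso.exists_singleton [IsEmpty (L.Relations 0)] [Finite M] [Finite M'] {R' : ℕ → ℕ∞}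
    {k : ℕ} (hM' : IsRandom L M' R' k) (hR' : 0 < R' (Nat.card M')) (hk : 0 < k) (a : M) :
    ∃ b : M', PIso L {(a, b)} := by
  obtain ⟨b, hb⟩ := (PIso.empty (L := L) (M := M) (M' := M')).exists_forth hM' hR' (by simpa) a
  exact ⟨b, by simpa using hb⟩

theorem PIso.trans_singleton {M'' : Type*} [L.Structure M''] {a : M} {b : M'} {c : M''}
    (h : PIso L {(a, b)}) (h' : PIso L {(b, c)}) : PIso L {(a, c)} := by
  refine (h.comp h').mono ?_
  rintro _ rfl
  exact ⟨b, rfl, rfl⟩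

/-- Two urelements of `M` with the same type share a partner `c` in `M'`. Membership of either one
in a set is equivalent to membership of `c` in the partner of that set, so sets do not separate
urelements of the same type. -/
theorem Sys.diag [IsEmpty (L.Relations 0)] [Finite M] [Finite M'] {S : Stage M m t}
    {S' : Stage M' m t} {E : V M t → V M' t → Prop} (hE : Sys L S S' E) {R' : ℕ → ℕ∞} {k : ℕ}
    (hM' : IsRandom L M' R' k) (hR' : 0 < R' (Nat.card M')) (hk : 0 < k) :
    Sys L S S (Diag S) where
  left_mem x y h := h.2.1
  right_mem := by
    rintro x _ ⟨rfl, h, -⟩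
    exact h
  left_ne x y h := h.2.2
  right_ne := by
    rintro x _ ⟨rfl, -, h⟩
    exact h
  left_total x hx := or_iff_not_imp_left.2 fun h => ⟨x, rfl, hx, fun a ha => h ⟨a, ha⟩⟩
  right_total x hx := or_iff_not_imp_left.2 fun h => ⟨x, rfl, hx, fun a ha => h ⟨a, ha⟩⟩
  inj := by
    rintro x _ x' _ ⟨rfl, -⟩ ⟨rfl, -⟩
    rfl
  mem_iff := by
    rintro x y x' _ hxy ⟨rfl, hx', hne⟩
    rcases hxy with ⟨rfl, -⟩ | ⟨a, b, rfl, rfl, hab⟩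
    · rfl
    · obtain ⟨c, hc⟩ := PIso.exists_singleton hM' hR' hk a
      have hbc := hab.symm_singleton.trans_singleton hc
      obtain ⟨w, hw⟩ := (hE.left_total x' hx').resolve_left fun ⟨a, ha⟩ => hne a ha
      exact (hE.mem_iff _ _ _ _ (Or.inr ⟨a, c, rfl, rfl, hc⟩) hw).trans
        (hE.mem_iff _ _ _ _ (Or.inr ⟨b, c, rfl, rfl, hbc⟩) hw).symm
  pred_iff := by
    rintro x _ ⟨rfl, -⟩ ℓ
    rfl

/-- The graph of a partial map which moves urelements as `p` and fixes the sets of the stage. -/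
def extGraph (S : Stage M m t) (p : Set (M × M)) : Set (V M t × V M t) :=
  {x | Diag S x.1 x.2} ∪ (fun x : M × M => (ur t x.1, ur t x.2)) '' p

theorem urPairs_extGraph (S : Stage M m t) (p : Set (M × M)) : urPairs (extGraph S p) = p := by
  ext ⟨a, b⟩
  constructor
  · rintro (⟨-, -, h⟩ | ⟨⟨a', b'⟩, h, hab⟩)
    · exact (h a rfl).elim
    · simp only [Prod.mk.injEq, (ur_injective t).eq_iff] at hab
      rwa [← hab.1, ← hab.2]
  · exact fun h => Or.inr ⟨(a, b), h, rfl⟩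

theorem Good.extGraph {S : Stage M m t} {p : Set (M × M)} (hp : PIso L p) :
    Good L (Diag S) (extGraph S p) := by
  refine ⟨?_, by rwa [urPairs_extGraph]⟩
  rintro x (h | ⟨y, -, rfl⟩)
  · exact Or.inr h
  · exact Or.inl ⟨_, _, rfl⟩

/-- The subset of the stage defined by a formula with parameters. -/
def defSet (S : Stage M m t) [L.IsRelational] (θ : (plusDyn L m).Formula (Option (Fin r)))
    (b : Fin r → S.N) : Set (V M t) :=
  {a | ∃ ha : a ∈ S.N, S.Sat θ (fun i => i.elim ⟨a, ha⟩ b)}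

theorem mem_defSet [L.IsRelational] {S : Stage M m t}
    {θ : (plusDyn L m).Formula (Option (Fin r))} {b : Fin r → S.N} {a : V M t} (ha : a ∈ S.N) :
    a ∈ defSet S θ b ↔ S.Sat θ (fun i => i.elim ⟨a, ha⟩ b) :=
  ⟨fun h => h.2, fun h => ⟨ha, h⟩⟩

theorem Good.mem_defSet_iff [L.IsRelational] [Finite M] [Finite M'] [Nonempty M] [Nonempty M']
    {S : Stage M m t} {S' : Stage M' m t} {E : V M t → V M' t → Prop} (hE : Sys L S S' E)
    (hS : S.Regular) (hS' : S'.Regular) {R R' : ℕ → ℕ∞} {k s : ℕ} (hM : IsRandom L M R k)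
    (hR : 0 < R (Nat.card M)) (hM' : IsRandom L M' R' k) (hR' : 0 < R' (Nat.card M'))
    (hsk : s ≤ k) {θ : (plusDyn L m).Formula (Option (Fin r))} (hθ : WidthLE s θ)
    {q : Set (V M t × V M' t)} (hq : Good L E q) {b : Fin r → S.N} {b' : Fin r → S'.N}
    (hb : ∀ i, ((b i : V M t), (b' i : V M' t)) ∈ q) {a : V M t} {a' : V M' t} (ha : a ∈ S.N)
    (ha' : a' ∈ S'.N) (haq : (a, a') ∈ q) : a ∈ defSet S θ b ↔ a' ∈ defSet S' θ b' := by
  rw [mem_defSet ha, mem_defSet ha']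
  refine Good.sat_iff hE hS hS' hM hR hM' hR' hsk θ hθ _ _ (hq.mono ?_)
  rintro _ ⟨_ | i, rfl⟩
  · exact haq
  · exact hb i

/-- Each `a` in the stage has a counterpart `x` under an extension of `q`. Membership of `a` in the
sets given by `b₃`, `b₄` amounts to membership of `x` in those given by `b₁`, `b₂`, so an equality
between the latter is transported. -/
theorem defSet_eq_of_good [L.IsRelational] [Finite M] [Nonempty M] {S : Stage M m t}
    (hD : Sys L S S (Diag S)) (hS : S.Regular) {R : ℕ → ℕ∞} {k s : ℕ} (hM : IsRandom L M R k)
    (hR : 0 < R (Nat.card M)) (hsk : s ≤ k) {θ : (plusDyn L m).Formula (Option (Fin r))}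
    (hθ : WidthLE s θ) {q : Set (V M t × V M t)} (hq : Good L (Diag S) q)
    (hk : (urPairs q).ncard < k) {b₁ b₂ b₃ b₄ : Fin r → S.N}
    (h₁₃ : ∀ i, ((b₁ i : V M t), (b₃ i : V M t)) ∈ q)
    (h₂₄ : ∀ i, ((b₂ i : V M t), (b₄ i : V M t)) ∈ q) (h : defSet S θ b₁ = defSet S θ b₂) :
    defSet S θ b₃ = defSet S θ b₄ := by
  ext a
  by_cases ha : a ∈ S.N
  swap
  · exact iff_of_false (fun h => ha h.1) (fun h => ha h.1)
  obtain ⟨x, hx, hxq⟩ := hq.exists_back hD hS hM hR hk ha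
  rw [← hxq.mem_defSet_iff hD hS hS hM hR hM hR hsk hθ (fun i => Or.inr (h₁₃ i)) hx ha (Or.inl rfl),
    ← hxq.mem_defSet_iff hD hS hS hM hR hM hR hsk hθ (fun i => Or.inr (h₂₄ i)) hx ha (Or.inl rfl), h]

open Classical in
/-- The tuple `b` with the urelement `e` replaced by `y`. -/
noncomputable def subst {S : Stage M m t} (hS : S.Regular) (b : Fin r → S.N) (e y : M) :
    Fin r → S.N :=
  fun i => if (b i : V M t) = ur t e then ⟨ur t y, hS.ur_mem y⟩ else b i

theorem subst_of_eq {S : Stage M m t} (hS : S.Regular) {b : Fin r → S.N} {e : M} (y : M)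
    {i : Fin r} (h : (b i : V M t) = ur t e) : (subst hS b e y i : V M t) = ur t y := by
  simp [subst, h]

theorem subst_of_ne {S : Stage M m t} (hS : S.Regular) {b : Fin r → S.N} {e : M} (y : M)
    {i : Fin r} (h : (b i : V M t) ≠ ur t e) : subst hS b e y i = b i := by
  simp [subst, h]

theorem subst_self {S : Stage M m t} (hS : S.Regular) (b : Fin r → S.N) (e : M) :
    subst hS b e e = b := by
  funext i
  by_cases h : (b i : V M t) = ur t e
  · exact Subtype.ext ((subst_of_eq hS e h).trans h.symm)
  · exact subst_of_ne hS e h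

/-- The urelements other than `e` in the tuple `b`. -/
def rest {S : Stage M m t} (b : Fin r → S.N) (e : M) : Set M :=
  {c | c ≠ e ∧ ∃ i, (b i : V M t) = ur t c}

theorem ncard_rest_lt [Finite M] {S : Stage M m t} {b : Fin r → S.N} {e : M}
    (h : ∃ i, (b i : V M t) = ur t e) : (rest b e).ncard < r := by
  have h1 : (insert e (rest b e)).ncard = (rest b e).ncard + 1 :=
    Set.ncard_insert_of_notMem (fun h => h.1 rfl)
  have h2 : ur t '' insert e (rest b e) ⊆ Set.range fun i => (b i : V M t) := by
    rintro _ ⟨c, rfl | hc, rfl⟩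
    · exact h
    · exact hc.2
  have h3 := Set.ncard_le_ncard h2 (Set.finite_range _)
  rw [Set.ncard_image_of_injective _ (ur_injective t), h1, ← Set.image_univ] at h3
  have h4 := h3.trans (Set.ncard_image_le Set.finite_univ)
  simpa [Set.ncard_univ] using h4

/-- The diagonal of a set of urelements. -/
def diagOn (C : Set M) : Set (M × M) := (fun c => (c, c)) '' C

theorem PIso.diagOn (C : Set M) : PIso L (diagOn C) := by
  refine PIso.of_eq ?_
  rintro _ ⟨c, -, rfl⟩
  rfl

theorem subst_mem_extGraph {S : Stage M m t} (hS : S.Regular) (b : Fin r → S.N) (e : M)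
    {y y' : M} {p : Set (M × M)} (hy : (y, y') ∈ p) (hp : diagOn (rest b e) ⊆ p) (i : Fin r) :
    ((subst hS b e y i : V M t), (subst hS b e y' i : V M t)) ∈ extGraph S p := by
  by_cases h : (b i : V M t) = ur t e
  · rw [subst_of_eq hS y h, subst_of_eq hS y' h]
    exact Or.inr ⟨(y, y'), hy, rfl⟩
  · rw [subst_of_ne hS y h, subst_of_ne hS y' h]
    by_cases hur : ∃ c, (b i : V M t) = ur t c
    · obtain ⟨c, hc⟩ := hur
      refine Or.inr ⟨(c, c), hp ⟨c, ⟨?_, i, hc⟩, rfl⟩, by rw [hc]⟩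
      rintro rfl
      exact h hc
    · exact Or.inl ⟨rfl, (b i).2, fun a ha => hur ⟨a, ha⟩⟩

theorem PIso.insert_diagOn {C : Set M} {e y : M} (he : e ∉ C) (hy : y ∉ C)
    (hR : ∀ (n : ℕ) (R : L.Relations n) (z : Fin n → Option M), (∃ i, z i = none) →
      (∀ i d, z i = some d → d ∈ C) →
      (RelMap R (fun i => (z i).elim y id) ↔ RelMap R (fun i => (z i).elim e id))) :
    PIso L (insert (e, y) (CPT.diagOn C)) := by
  refine (PIso.diagOn C).insert_of_pullback (D := C) (g := id) hy ?_ ?_ ?_ ?_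
  · rintro _ ⟨c, hc, rfl⟩
    exact hc
  · rintro _ ⟨c, hc, rfl⟩
    rfl
  · rintro _ ⟨c, hc, rfl⟩ rfl
    exact he hc
  · intro n R z hn hz
    refine hR n R z hn fun i d hd => ?_
    obtain ⟨_, ⟨c, hc, rfl⟩, rfl⟩ := hz i d hd
    exact hc

theorem PIso.notMem_of_insert_diagOn {C : Set M} {e y : M} (he : e ∉ C)
    (h : PIso L (insert (e, y) (CPT.diagOn C))) : y ∉ C := by
  intro hy
  have : e = y := (h.1 (e, y) (Or.inl rfl) (y, y) (Or.inr ⟨y, hy, rfl⟩)).2 rfl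
  exact he (this ▸ hy)

theorem PIso.trans_insert_diagOn {C : Set M} {e y y' : M}
    (h : PIso L (insert (e, y) (CPT.diagOn C))) (h' : PIso L (insert (e, y') (CPT.diagOn C))) :
    PIso L (insert (y, y') (CPT.diagOn C)) := by
  refine (h.symm.comp h').mono ?_
  rintro _ (rfl | ⟨c, hc, rfl⟩)
  · exact ⟨e, Or.inl rfl, Or.inl rfl⟩
  · exact ⟨c, Or.inr ⟨c, hc, rfl⟩, Or.inr ⟨c, hc, rfl⟩⟩

/-- Two pairs with the same first pair of types can be joined through a common third element. -/
theorem exists_amalgam [Finite M] {R : ℕ → ℕ∞} {k : ℕ} (hM : IsRandom L M R k)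
    (hR : 0 < R (Nat.card M)) {C : Set M} (hC : C.ncard + 2 < k) {y₁ y₂ y₃ y₄ : M}
    (h₁₃ : PIso L (insert (y₁, y₃) (diagOn C))) (h₁₄ : PIso L (insert (y₁, y₄) (diagOn C)))
    (h₁ : y₁ ∉ C) (h₂ : y₂ ∉ C) (h₁₂ : y₁ ≠ y₂) :
    ∃ y₅, PIso L (insert (y₂, y₅) (insert (y₁, y₃) (diagOn C))) ∧
      PIso L (insert (y₂, y₅) (insert (y₁, y₄) (diagOn C))) := by
  classical
  -- `g` merges the inverses of the two maps `y₁ ↦ y₃` and `y₁ ↦ y₄`. An element with the type of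
  -- `y₂` pulled back along `g` is related to each of `y₃`, `y₄` over `C` as `y₂` is to `y₁`;
  -- formulas mentioning both `y₃` and `y₄` do not matter.
  let g : M → M := fun d => if d = y₃ ∨ d = y₄ then y₁ else d
  have hgC : ∀ c ∈ C, g c = c := by
    intro c hc
    have h3 : c ≠ y₃ := by
      rintro rfl
      exact h₁₃.notMem_of_insert_diagOn h₁ hc
    have h4 : c ≠ y₄ := by
      rintro rfl
      exact h₁₄.notMem_of_insert_diagOn h₁ hc
    simp [g, h3, h4]
  have hcard : (insert y₃ (insert y₄ C)).ncard < k :=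
    ((Set.ncard_insert_le _ _).trans (Nat.succ_le_succ (Set.ncard_insert_le _ _))).trans_lt hC
  obtain ⟨y₅, hy₅, h₅⟩ := hM.exists_realize hR (insert y₃ (insert y₄ C)) hcard
    (fun n R z => RelMap R fun i => (z i).elim y₂ g)
  have key : ∀ y, y = y₃ ∨ y = y₄ → PIso L (insert (y₁, y) (diagOn C)) →
      PIso L (insert (y₂, y₅) (insert (y₁, y) (diagOn C))) := by
    intro y hy h
    have hgy : g y = y₁ := if_pos hy
    have hyD : y ∈ insert y₃ (insert y₄ C) := by
      rcases hy with rfl | rfl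
      · exact Or.inl rfl
      · exact Or.inr (Or.inl rfl)
    have hsub : ∀ x ∈ insert (y₁, y) (diagOn C), x.2 ∈ insert y₃ (insert y₄ C) := by
      rintro _ (rfl | ⟨c, hc, rfl⟩)
      · exact hyD
      · exact Or.inr (Or.inr hc)
    refine h.insert_of_pullback hy₅ hsub ?_ ?_ ?_ (g := g)
    · rintro _ (rfl | ⟨c, hc, rfl⟩)
      · exact hgy
      · exact hgC c hc
    · rintro _ (rfl | ⟨c, hc, rfl⟩)
      · exact h₁₂
      · rintro rfl
        exact h₂ hc
    · intro n R z hn hz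
      refine h₅ n R z hn fun i d hd => ?_
      obtain ⟨x, hx, rfl⟩ := hz i d hd
      exact hsub x hx
  exact ⟨y₅, key _ (Or.inl rfl) h₁₃, key _ (Or.inr rfl) h₁₄⟩

/-- If a formula defines few sets, then a parameter can be replaced by any other of the same type
over the remaining parameters. -/
theorem defSet_subst_eq [L.IsRelational] [Finite M] [Nonempty M] {S : Stage M m t}
    (hD : Sys L S S (Diag S)) (hS : S.Regular) {R : ℕ → ℕ∞} {k s : ℕ} (hM : IsRandom L M R k)
    (hs : 0 < s) (hsk : 3 * s ≤ k) {θ : (plusDyn L m).Formula (Option (Fin r))}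
    (hθ : WidthLE s θ) (hr : r ≤ s)
    (hfew : {X | ∃ b, X = defSet S θ b}.encard < R (Nat.card M)) (b : Fin r → S.N) {e : M}
    (he : ∃ i, (b i : V M t) = ur t e) {y₃ y₄ : M}
    (h₃ : PIso L (insert (e, y₃) (diagOn (rest b e))))
    (h₄ : PIso L (insert (e, y₄) (diagOn (rest b e)))) :
    defSet S θ (subst hS b e y₃) = defSet S θ (subst hS b e y₄) := by
  have hR : 0 < R (Nat.card M) := (zero_le).trans_lt hfew
  have hC : (rest b e).ncard < r := ncard_rest_lt he
  have heC : e ∉ rest b e := fun h => h.1 rfl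
  have hcount : R (Nat.card M) ≤
      {y | PIso L (insert (e, y) (diagOn (rest b e)))}.encard := by
    refine (hM.le_encard (rest b e) (by omega)
      (fun n R z => RelMap R fun i => (z i).elim e id)).trans (Set.encard_le_encard ?_)
    rintro y ⟨hy, h⟩
    exact PIso.insert_diagOn heC hy h
  -- Pigeonhole: the type of `e` has more realizations than `θ` defines sets.
  obtain ⟨y₁, h₁, y₂, h₂, h₁₂, hX⟩ := Set.exists_ne_map_eq_of_encard_lt_of_maps_to
    (hfew.trans_le hcount) (f := fun y => defSet S θ (subst hS b e y))
    (fun y _ => ⟨_, rfl⟩)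
  obtain ⟨y₅, h₃₅, h₄₅⟩ := exists_amalgam hM hR (y₂ := y₂) (by omega)
    (h₁.trans_insert_diagOn h₃) (h₁.trans_insert_diagOn h₄) (h₁.notMem_of_insert_diagOn heC)
    (h₂.notMem_of_insert_diagOn heC) h₁₂
  -- The matching `y₁ ↦ y`, `y₂ ↦ y₅` over the remaining parameters transports the equality `hX`. It
  -- has at most `(s - 1) + 2` pairs, which is below `3 * s` because `s` is positive.
  have key : ∀ y, PIso L (insert (y₂, y₅) (insert (y₁, y) (diagOn (rest b e)))) →
      defSet S θ (subst hS b e y) = defSet S θ (subst hS b e y₅) := by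
    intro y hy
    have hcard : (urPairs (extGraph S (insert (y₂, y₅) (insert (y₁, y) (diagOn (rest b e)))))).ncard
        < k := by
      rw [urPairs_extGraph]
      have h1 := Set.ncard_insert_le (y₂, y₅) (insert (y₁, y) (diagOn (rest b e)))
      have h2 := Set.ncard_insert_le (y₁, y) (diagOn (rest b e))
      have h3 : (diagOn (rest b e)).ncard ≤ (rest b e).ncard := Set.ncard_image_le (Set.toFinite _)
      omega
    refine defSet_eq_of_good hD hS hM hR (by omega) hθ (Good.extGraph hy) hcard
      (subst_mem_extGraph hS b e ?_ ?_) (subst_mem_extGraph hS b e ?_ ?_) hX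
    · exact Or.inr (Or.inl rfl)
    · exact fun x hx => Or.inr (Or.inr hx)
    · exact Or.inl rfl
    · exact fun x hx => Or.inr (Or.inr hx)
  exact (key y₃ h₃₅).trans (key y₄ h₄₅).symm

end Exchange

/-! ### Invariance of the definable sets -/

section Invariance

variable {L : FirstOrder.Language.{u, v}} {M : Type w} {M' : Type w'} [L.Structure M]
  [L.Structure M'] {m t r : ℕ}

/-- There is a new element with the type of `e` over `C` which is in no relation with `a`. -/
theorem exists_free [Finite M] {R : ℕ → ℕ∞} {k : ℕ} (hM : IsRandom L M R k)
    (hR : 0 < R (Nat.card M)) {C : Set M} (hC : C.ncard + 1 < k) {e a : M} (he : e ∉ C)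
    (ha : a ∉ C) :
    ∃ y, y ≠ a ∧ PIso L (insert (e, y) (diagOn C)) ∧
      ∀ (n : ℕ) (Q : L.Relations n) (v : Fin n → M), (∀ i, v i = y ∨ v i = a ∨ v i ∈ C) →
        (∃ i, v i = y) → (∃ i, v i = a) → ¬ RelMap Q v := by
  classical
  -- The prescribed type copies `e`, except that every atomic formula mentioning `a` is made false.
  -- As `a ∉ C`, nothing over `C` is altered.
  obtain ⟨y, hy, h⟩ := hM.exists_realize hR (insert a C) ((Set.ncard_insert_le _ _).trans_lt hC)
    (fun n Q z => (∀ i, z i ≠ some a) ∧ RelMap Q fun i => (z i).elim e id)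
  have hya : y ≠ a := fun h => hy (Or.inl h)
  have hyC : y ∉ C := fun h => hy (Or.inr h)
  refine ⟨y, hya, PIso.insert_diagOn he hyC ?_, ?_⟩
  · intro n Q z hn hz
    rw [h n Q z hn fun i d hd => Or.inr (hz i d hd)]
    exact and_iff_right fun i hi => ha (hz i a hi)
  · rintro n Q v hv ⟨i, hi⟩ ⟨j, hj⟩ hQ
    have := h n Q (fun i => if v i = y then none else some (v i)) ⟨i, by simp [hi]⟩ ?_
    · have hv' : (fun i => (if v i = y then none else some (v i)).elim y id) = v := by
        funext l
        by_cases hl : v l = y <;> simp [hl]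
      rw [hv'] at this
      exact (this.1 hQ).1 j (by simp [hj, hya.symm])
    · intro l d hd
      by_cases hl : v l = y
      · simp [hl] at hd
      · simp only [hl, if_false, Option.some.injEq] at hd
        exact hd ▸ (hv l).resolve_left hl

/-- The atomic formulas which mix `a` and `b j` are false. -/
def FreeAt (L : FirstOrder.Language.{u, v}) [L.Structure M] {S : Stage M m t} (b : Fin r → S.N)
    (a : M) (j : Fin r) : Prop :=
  ∀ (n : ℕ) (Q : L.Relations n) (v : Fin n → M),
    (∀ i, v i = a ∨ ∃ l, (b l : V M t) = ur t (v i)) → (∃ i, v i = a) →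
      (∃ i, (b j : V M t) = ur t (v i)) → ¬ RelMap Q v

theorem Good.trans_range {M'' : Type*} [L.Structure M''] {ι : Type*}
    {E : V M t → V M' t → Prop} {E' : V M' t → V M'' t → Prop} {E'' : V M t → V M'' t → Prop}
    (hE₀ : ∀ x y, E x y → ∀ a, x ≠ ur t a) (hE : ∀ x y, E x y → ∀ a, y ≠ ur t a)
    (hE' : ∀ x y, E' x y → ∀ a, x ≠ ur t a)
    (hEE : ∀ x y z, E x y → E' y z → E'' x z) {f : ι → V M t} {g : ι → V M' t} {h : ι → V M'' t}
    (h₁ : Good L E (Set.range fun i => (f i, g i)))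
    (h₂ : Good L E' (Set.range fun i => (g i, h i))) :
    Good L E'' (Set.range fun i => (f i, h i)) := by
  have key : ∀ i, (∃ a b c, f i = ur t a ∧ g i = ur t b ∧ h i = ur t c) ∨
      E (f i) (g i) ∧ E' (g i) (h i) := by
    intro i
    rcases h₁.1 _ ⟨i, rfl⟩ with ⟨a, b, hab⟩ | h1 <;> rcases h₂.1 _ ⟨i, rfl⟩ with ⟨b', c, hbc⟩ | h2
    · simp only [Prod.mk.injEq] at hab hbc
      exact Or.inl ⟨a, b, c, hab.1, hab.2, hbc.2⟩
    · simp only [Prod.mk.injEq] at hab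
      exact absurd hab.2 (hE' _ _ h2 b)
    · simp only [Prod.mk.injEq] at hbc
      exact absurd hbc.1 (hE _ _ h1 b')
    · exact Or.inr ⟨h1, h2⟩
  constructor
  · rintro _ ⟨i, rfl⟩
    rcases key i with ⟨a, b, c, ha, hb, hc⟩ | ⟨h1, h2⟩
    · exact Or.inl ⟨a, c, Prod.ext ha hc⟩
    · exact Or.inr (hEE _ _ _ h1 h2)
  · refine (h₁.2.comp h₂.2).mono ?_
    rintro ⟨a, c⟩ ⟨i, hi⟩
    simp only [Prod.mk.injEq] at hi
    rcases key i with ⟨a', b, c', ha, hb, hc⟩ | ⟨h1, h2⟩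
    · exact ⟨b, ⟨i, Prod.ext hi.1 hb⟩, ⟨i, Prod.ext hb hi.2⟩⟩
    · exact absurd hi.1 (hE₀ _ _ h1 a)

theorem good_range_subst {S : Stage M m t} (hS : S.Regular) (b : Fin r → S.N) {e y : M}
    (h : PIso L (insert (e, y) (diagOn (rest b e)))) :
    Good L (Diag S) (Set.range fun i => ((b i : V M t), (subst hS b e y i : V M t))) := by
  refine (Good.extGraph h).mono ?_
  rintro _ ⟨i, rfl⟩
  have := subst_mem_extGraph hS b e (Or.inl rfl) (Set.subset_insert (e, y) (diagOn (rest b e))) i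
  rwa [subst_self] at this

theorem Good.diag_trans {S : Stage M m t} {b b' b'' : Fin r → S.N}
    (h : Good L (Diag S) (Set.range fun i => ((b i : V M t), (b' i : V M t))))
    (h' : Good L (Diag S) (Set.range fun i => ((b' i : V M t), (b'' i : V M t)))) :
    Good L (Diag S) (Set.range fun i => ((b i : V M t), (b'' i : V M t))) := by
  refine Good.trans_range (fun x y h => h.2.2) ?_ (fun x y h => h.2.2) ?_ h h'
  · rintro x _ ⟨rfl, -, h⟩
    exact h
  · rintro x _ _ ⟨rfl, -⟩ h
    exact h

/-- One parameter can be moved away from `a` without changing the set defined. -/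
theorem exists_subst_free [L.IsRelational] [Finite M] [Nonempty M] {S : Stage M m t}
    (hD : Sys L S S (Diag S)) (hS : S.Regular) {R : ℕ → ℕ∞} {k s : ℕ} (hM : IsRandom L M R k)
    (hs : 0 < s) (hsk : 3 * s ≤ k) {θ : (plusDyn L m).Formula (Option (Fin r))}
    (hθ : WidthLE s θ) (hr : r ≤ s)
    (hfew : {X | ∃ b, X = defSet S θ b}.encard < R (Nat.card M)) (b : Fin r → S.N) {e a : M}
    (he : ∃ i, (b i : V M t) = ur t e) (ha : a ∉ rest b e) :
    ∃ y, y ≠ a ∧ defSet S θ b = defSet S θ (subst hS b e y) ∧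
      Good L (Diag S) (Set.range fun i => ((b i : V M t), (subst hS b e y i : V M t))) ∧
      ∀ (n : ℕ) (Q : L.Relations n) (v : Fin n → M),
        (∀ i, v i = y ∨ v i = a ∨ v i ∈ rest b e) →
          (∃ i, v i = y) → (∃ i, v i = a) → ¬ RelMap Q v := by
  have hC := ncard_rest_lt he
  obtain ⟨y, hya, hy, hfree⟩ := exists_free hM ((zero_le).trans_lt hfew) (by omega)
    (fun h => h.1 rfl : e ∉ rest b e) ha
  refine ⟨y, hya, ?_, good_range_subst hS b hy, hfree⟩
  -- The original tuple is the substitution of `e` for itself.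
  have := defSet_subst_eq hD hS hM hs hsk hθ hr hfew b he (y₃ := e) (y₄ := y) ?_ hy
  · rwa [subst_self] at this
  · refine PIso.of_eq ?_
    rintro _ (rfl | ⟨c, -, rfl⟩) <;> rfl

/-- Induction on the set of positions already freed. The base case removes `a` itself from the
tuple, and each further step replaces the urelement at one position by one unrelated to `a`. -/
theorem exists_free_tuple [L.IsRelational] [Finite M] [Nonempty M] {S : Stage M m t}
    (hD : Sys L S S (Diag S)) (hS : S.Regular) {R : ℕ → ℕ∞} {k s : ℕ} (hM : IsRandom L M R k)
    (hs : 0 < s) (hsk : 3 * s ≤ k) {θ : (plusDyn L m).Formula (Option (Fin r))}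
    (hθ : WidthLE s θ) (hr : r ≤ s)
    (hfew : {X | ∃ b, X = defSet S θ b}.encard < R (Nat.card M)) (b : Fin r → S.N) (a : M)
    (J : Finset (Fin r)) :
    ∃ b' : Fin r → S.N, defSet S θ b = defSet S θ b' ∧
      Good L (Diag S) (Set.range fun i => ((b i : V M t), (b' i : V M t))) ∧
      (∀ i, (b' i : V M t) ≠ ur t a) ∧ ∀ j ∈ J, FreeAt L b' a j := by
  classical
  induction J using Finset.induction_on with
  | empty =>
    by_cases ha : ∃ i, (b i : V M t) = ur t a
    · obtain ⟨y, hya, h1, h2, -⟩ := exists_subst_free hD hS hM hs hsk hθ hr hfew b ha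
        (fun h => h.1 rfl)
      refine ⟨_, h1, h2, fun i => ?_, by simp⟩
      by_cases hi : (b i : V M t) = ur t a
      · rw [subst_of_eq hS y hi]
        exact fun h => hya (ur_injective t h)
      · rwa [subst_of_ne hS y hi]
    · refine ⟨b, rfl, ?_, fun i hi => ha ⟨i, hi⟩, by simp⟩
      refine (Good.extGraph (PIso.diagOn Set.univ)).mono ?_
      rintro _ ⟨i, rfl⟩
      by_cases hur : ∃ c, (b i : V M t) = ur t c
      · obtain ⟨c, hc⟩ := hur
        exact Or.inr ⟨(c, c), ⟨c, trivial, rfl⟩, Prod.ext hc.symm hc.symm⟩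
      · exact Or.inl ⟨rfl, (b i).2, fun a ha => hur ⟨a, ha⟩⟩
  | insert j J _ ih =>
    obtain ⟨b₁, hX, hg, hne, hfree⟩ := ih
    by_cases hj : ∃ e, (b₁ j : V M t) = ur t e
    swap
    · refine ⟨b₁, hX, hg, hne, fun i hi => ?_⟩
      rcases Finset.mem_insert.1 hi with rfl | hi
      · rintro n Q v - - ⟨l, hl⟩
        exact (hj ⟨_, hl⟩).elim
      · exact hfree i hi
    obtain ⟨e, he⟩ := hj
    obtain ⟨y, hya, h1, h2, h3⟩ := exists_subst_free hD hS hM hs hsk hθ hr hfew b₁ (a := a) ⟨j, he⟩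
      (fun h => h.2.elim fun i hi => hne i hi)
    have hval : ∀ l c, (subst hS b₁ e y l : V M t) = ur t c → c = y ∨ c ∈ rest b₁ e := by
      intro l c hc
      by_cases hl : (b₁ l : V M t) = ur t e
      · rw [subst_of_eq hS y hl] at hc
        exact Or.inl (ur_injective t hc).symm
      · rw [subst_of_ne hS y hl] at hc
        refine Or.inr ⟨?_, l, hc⟩
        rintro rfl
        exact hl hc
    refine ⟨subst hS b₁ e y, hX.trans h1, hg.diag_trans h2, fun i hi => ?_, fun i hi => ?_⟩
    · rcases hval i a hi with rfl | h
      · exact hya rfl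
      · exact h.2.elim fun i hi => hne i hi
    · rintro n Q v hv hva ⟨l, hl⟩
      have hv' : ∀ i, v i = y ∨ v i = a ∨ v i ∈ rest b₁ e := by
        intro i
        rcases hv i with h | ⟨l, hl⟩
        · exact Or.inr (Or.inl h)
        · rcases hval l _ hl with h | h
          · exact Or.inl h
          · exact Or.inr (Or.inr h)
      -- Positions freed earlier stay free: a tuple containing `y` is excluded by the choice of `y`,
      -- and any other involves only `a` and old parameters.
      by_cases hy : ∃ i, v i = y
      · exact h3 n Q v hv' hy hva
      push Not at hy
      by_cases hi' : (b₁ i : V M t) = ur t e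
      · rw [subst_of_eq hS y hi'] at hl
        exact (hy l (ur_injective t hl).symm).elim
      · rw [subst_of_ne hS y hi'] at hl
        have hiJ : i ∈ J := by
          refine (Finset.mem_insert.1 hi).resolve_left ?_
          rintro rfl
          exact hi' he
        refine hfree i hiJ n Q v (fun i => ?_) hva ⟨l, hl⟩
        rcases hv' i with h | h | h
        · exact (hy i h).elim
        · exact Or.inl h
        · exact Or.inr h.2

/-- Tuples which are free from `a` and `a'` correspond over `a` and `a'`. -/
theorem PIso.insert_of_free {S : Stage M m t} {S' : Stage M' m t} {b : Fin r → S.N}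
    {b' : Fin r → S'.N} {a : M} {a' : M'} (haa' : PIso L {(a, a')})
    (hp : PIso L (urPairs (Set.range fun i => ((b i : V M t), (b' i : V M' t)))))
    (ha : ∀ i, (b i : V M t) ≠ ur t a) (ha' : ∀ i, (b' i : V M' t) ≠ ur t a')
    (hb : ∀ j, FreeAt L b a j) (hb' : ∀ j, FreeAt L b' a' j) :
    PIso L (insert (a, a') (urPairs (Set.range fun i => ((b i : V M t), (b' i : V M' t))))) := by
  have hpair : ∀ x ∈ urPairs (Set.range fun i => ((b i : V M t), (b' i : V M' t))),
      ∃ l, (b l : V M t) = ur t x.1 ∧ (b' l : V M' t) = ur t x.2 := by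
    rintro x ⟨l, hl⟩
    exact ⟨l, congrArg Prod.fst hl, congrArg Prod.snd hl⟩
  have hne : ∀ x ∈ urPairs (Set.range fun i => ((b i : V M t), (b' i : V M' t))),
      x.1 ≠ a ∧ x.2 ≠ a' := by
    intro x hx
    obtain ⟨l, h1, h2⟩ := hpair x hx
    exact ⟨fun h => ha l (h ▸ h1), fun h => ha' l (h ▸ h2)⟩
  constructor
  · rintro x (rfl | hx) y (rfl | hy)
    · simp
    · exact iff_of_false (hne y hy).1.symm (hne y hy).2.symm
    · exact iff_of_false (hne x hx).1 (hne x hx).2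
    · exact hp.1 x hx y hy
  · intro n Q z hz
    by_cases h1 : ∀ i, z i = (a, a')
    · exact haa'.2 n Q z h1
    by_cases h2 : ∃ i, z i = (a, a')
    · push Not at h1
      obtain ⟨i, hi⟩ := h1
      obtain ⟨j, hj⟩ := h2
      obtain ⟨l, hl, hl'⟩ := hpair _ ((hz i).resolve_left hi)
      refine iff_of_false (hb l n Q _ (fun i => ?_) ⟨j, by rw [hj]⟩ ⟨i, hl⟩)
        (hb' l n Q _ (fun i => ?_) ⟨j, by rw [hj]⟩ ⟨i, hl'⟩)
      · rcases hz i with h | h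
        · exact Or.inl (by rw [h])
        · obtain ⟨l, hl, -⟩ := hpair _ h
          exact Or.inr ⟨l, hl⟩
      · rcases hz i with h | h
        · exact Or.inl (by rw [h])
        · obtain ⟨l, -, hl⟩ := hpair _ h
          exact Or.inr ⟨l, hl⟩
    · push Not at h2
      exact hp.2 n Q z fun i => (hz i).resolve_left (h2 i)

/-- If a formula defines few sets, then corresponding parameters define sets with corresponding
elements. -/
theorem mem_defSet_iff_of_corr [L.IsRelational] [IsEmpty (L.Relations 0)] [Finite M] [Finite M']
    [Nonempty M] [Nonempty M'] {S : Stage M m t} {S' : Stage M' m t}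
    {E : V M t → V M' t → Prop} (hE : Sys L S S' E) (hS : S.Regular) (hS' : S'.Regular)
    {R R' : ℕ → ℕ∞} {k s : ℕ} (hM : IsRandom L M R k) (hM' : IsRandom L M' R' k)
    (hs : 0 < s) (hsk : 3 * s ≤ k) {θ : (plusDyn L m).Formula (Option (Fin r))}
    (hθ : WidthLE s θ) (hr : r ≤ s)
    (hfew : {X | ∃ b, X = defSet S θ b}.encard < R (Nat.card M))
    (hfew' : {X | ∃ b, X = defSet S' θ b}.encard < R' (Nat.card M'))
    {b : Fin r → S.N} {b' : Fin r → S'.N}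
    (hb : Good L E (Set.range fun i => ((b i : V M t), (b' i : V M' t)))) {a : V M t} {a' : V M' t}
    (haa' : Corr L E a a') : a ∈ defSet S θ b ↔ a' ∈ defSet S' θ b' := by
  have hR : 0 < R (Nat.card M) := (zero_le).trans_lt hfew
  have hR' : 0 < R' (Nat.card M') := (zero_le).trans_lt hfew'
  rcases haa' with h | ⟨a, a', rfl, rfl, haa'⟩
  · exact (hb.insert_of_rel hE h).mem_defSet_iff hE hS hS' hM hR hM' hR' (by omega) hθ
      (fun i => Or.inr ⟨i, rfl⟩) (hE.left_mem _ _ h) (hE.right_mem _ _ h) (Or.inl rfl)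
  -- The given tuples may be related to `a` and `a'` in different ways. They are replaced by free
  -- tuples `c`, `c'` defining the same sets, which are matched along `c → b → b' → c'`; the pair
  -- `(a, a')` can then be added.
  obtain ⟨c, hX, hg, hc, hfree⟩ := exists_free_tuple (hE.diag hM' hR' (by omega)) hS hM hs hsk hθ hr
    hfew b a Finset.univ
  obtain ⟨c', hX', hg', hc', hfree'⟩ := exists_free_tuple (hE.symm.diag hM hR (by omega)) hS' hM'
    hs hsk hθ hr hfew' b' a' Finset.univ
  have hDne : ∀ x y, Diag S x y → ∀ a, y ≠ ur t a := by
    rintro x _ ⟨rfl, -, h⟩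
    exact h
  have hgs : Good L (Diag S) (Set.range fun i => ((c i : V M t), (b i : V M t))) := by
    refine ⟨?_, hg.symm.2.mono ?_⟩
    · rintro _ ⟨i, rfl⟩
      rcases hg.1 _ ⟨i, rfl⟩ with ⟨x, y, h⟩ | h
      · simp only [Prod.mk.injEq] at h
        exact Or.inl ⟨y, x, Prod.ext h.2 h.1⟩
      · exact Or.inr ⟨h.1.symm, (c i).2, hDne _ _ h⟩
    · rintro ⟨x, y⟩ ⟨i, hi⟩
      exact ⟨i, congrArg Prod.swap hi⟩
  have hcb : Good L E (Set.range fun i => ((c i : V M t), (b' i : V M' t))) := by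
    refine Good.trans_range (fun x y h => h.2.2) hDne hE.left_ne ?_ hgs hb
    rintro x _ z ⟨rfl, -⟩ h
    exact h
  have hcc : Good L E (Set.range fun i => ((c i : V M t), (c' i : V M' t))) := by
    refine Good.trans_range hE.left_ne hE.right_ne (fun x y h => h.2.2) ?_ hcb hg'
    rintro x y _ h ⟨rfl, -⟩
    exact h
  rw [hX, hX']
  exact (hcc.insert_ur (haa'.insert_of_free hcc.2 hc hc' (fun j => hfree j (Finset.mem_univ j))
    fun j => hfree' j (Finset.mem_univ j))).mem_defSet_iff hE hS hS' hM hR hM' hR' (by omega) hθ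
      (fun i => Or.inr ⟨i, rfl⟩) (hS.ur_mem a) (hS'.ur_mem a') (Or.inl rfl)

end Invariance

/-! ### The correspondence between the next stages -/

section Step

variable {L : FirstOrder.Language.{u, v}} {M : Type w} {M' : Type w'} [L.Structure M]
  [L.Structure M'] {m t r : ℕ}

theorem Corr.left_mem {S : Stage M m t} {S' : Stage M' m t} {E : V M t → V M' t → Prop}
    (hE : Sys L S S' E) (hS : S.Regular) {x : V M t} {y : V M' t} (h : Corr L E x y) :
    x ∈ S.N := by
  rcases h with h | ⟨a, b, rfl, -, -⟩
  · exact hE.left_mem x y h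
  · exact hS.ur_mem a

theorem Corr.good [IsEmpty (L.Relations 0)] {S : Stage M m t} {S' : Stage M' m t}
    {E : V M t → V M' t → Prop} (hE : Sys L S S' E) {x : V M t} {y : V M' t}
    (h : Corr L E x y) : Good L E {(x, y)} := by
  rcases h with h | ⟨a, b, rfl, rfl, hab⟩
  · refine ⟨?_, PIso.empty.mono ?_⟩
    · rintro _ rfl
      exact Or.inr h
    · rintro ⟨a, b⟩ hab
      exact hE.left_ne _ _ h a (congrArg Prod.fst hab).symm
  · refine ⟨?_, hab.mono ?_⟩
    · rintro _ rfl
      exact Or.inl ⟨a, b, rfl⟩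
    · rintro ⟨a', b'⟩ h
      exact Prod.ext (ur_injective t (congrArg Prod.fst h)) (ur_injective t (congrArg Prod.snd h))

theorem Sys.exists_corr [IsEmpty (L.Relations 0)] [Finite M] [Finite M'] {S : Stage M m t}
    {S' : Stage M' m t} {E : V M t → V M' t → Prop} (hE : Sys L S S' E) {R' : ℕ → ℕ∞} {k : ℕ}
    (hM' : IsRandom L M' R' k) (hR' : 0 < R' (Nat.card M')) (hk : 0 < k) {x : V M t}
    (hx : x ∈ S.N) : ∃ y, Corr L E x y := by
  rcases hE.left_total x hx with ⟨a, rfl⟩ | ⟨y, hy⟩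
  · obtain ⟨b, hb⟩ := PIso.exists_singleton hM' hR' hk a
    exact ⟨ur t b, Or.inr ⟨a, b, rfl, rfl, hb⟩⟩
  · exact ⟨y, Or.inl hy⟩

theorem Sys.exists_tuple [IsEmpty (L.Relations 0)] [Finite M] [Finite M'] {S : Stage M m t}
    {S' : Stage M' m t} {E : V M t → V M' t → Prop} (hE : Sys L S S' E) (hS' : S'.Regular)
    {R' : ℕ → ℕ∞} {k : ℕ} (hM' : IsRandom L M' R' k) (hR' : 0 < R' (Nat.card M')) (hr : r ≤ k)
    (b : Fin r → S.N) :
    ∃ b' : Fin r → S'.N, Good L E (Set.range fun i => ((b i : V M t), (b' i : V M' t))) := by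
  classical
  suffices H : ∀ J : Finset (Fin r), ∃ b' : Fin r → V M' t, (∀ i ∈ J, b' i ∈ S'.N) ∧
      Good L E ((fun i => ((b i : V M t), b' i)) '' J) by
    obtain ⟨b', hb', h⟩ := H Finset.univ
    refine ⟨fun i => ⟨b' i, hb' i (Finset.mem_univ i)⟩, h.mono ?_⟩
    rintro _ ⟨i, rfl⟩
    exact ⟨i, Finset.mem_coe.2 (Finset.mem_univ i), rfl⟩
  intro J
  induction J using Finset.induction_on with
  | empty =>
    rcases isEmpty_or_nonempty (Fin r) with h | ⟨⟨i⟩⟩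
    · refine ⟨isEmptyElim, by simp, by simp, PIso.empty.mono ?_⟩
      rintro _ ⟨i, -⟩
      exact isEmptyElim i
    -- Only some element of `V M' t` is needed here, as values off `J` are arbitrary.
    · obtain ⟨y, -, -⟩ := Good.exists_forth (q := ∅) hE hS' hM' hR' ⟨by simp, PIso.empty⟩
        (by simpa [urPairs] using i.pos.trans_le hr) (b i).2
      refine ⟨fun _ => y, by simp, by simp, PIso.empty.mono ?_⟩
      rintro _ ⟨i, hi, -⟩
      simp at hi
  | insert j J hj ih =>
    obtain ⟨b', hb', h⟩ := ih
    have hcard : (urPairs ((fun i => ((b i : V M t), b' i)) '' (J : Set (Fin r)))).ncard < k := by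
      have h1 : (urPairs ((fun i => ((b i : V M t), b' i)) '' (J : Set (Fin r)))).encard ≤ J.card :=
        ((encard_urPairs_le _).trans (Set.encard_image_le _ _)).trans (by simp)
      rw [← Set.Finite.cast_ncard_eq (Set.toFinite _)] at h1
      have h2 : J.card < r := by
        have := Finset.card_lt_univ_of_notMem hj
        simpa using this
      exact (Nat.cast_le.1 h1).trans_lt (h2.trans_le hr)
    obtain ⟨y, hy, hg⟩ := h.exists_forth hE hS' hM' hR' hcard (b j).2
    have hne : ∀ i ∈ J, i ≠ j := by
      rintro i hi rfl
      exact hj hi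
    refine ⟨Function.update b' j y, fun i hi => ?_, hg.mono ?_⟩
    · rcases Finset.mem_insert.1 hi with rfl | hi
      · simpa using hy
      · simpa [hne i hi] using hb' i hi
    · rintro _ ⟨i, hi, rfl⟩
      rcases Finset.mem_insert.1 (Finset.mem_coe.1 hi) with rfl | hi
      · exact Or.inl (by simp)
      · exact Or.inr ⟨i, hi, by simp [hne i hi]⟩

variable (L) in
/-- Corresponding elements belong to both sets or to neither. -/
def SetCorr (E : V M t → V M' t → Prop) (X : Set (V M t)) (Y : Set (V M' t)) : Prop :=
  ∀ z z', Corr L E z z' → (z ∈ X ↔ z' ∈ Y)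

theorem SetCorr.symm {E : V M t → V M' t → Prop} {X : Set (V M t)} {Y : Set (V M' t)}
    (h : SetCorr L E X Y) : SetCorr L (flip E) Y X :=
  fun z z' hz => (h z' z hz.symm).symm

/-- Every element of the stage has a partner, so a subset of the stage can be recovered from any set
corresponding to it. This makes the correspondence of sets one-to-one. -/
theorem SetCorr.subset [IsEmpty (L.Relations 0)] [Finite M] [Finite M'] {S : Stage M m t}
    {S' : Stage M' m t} {E : V M t → V M' t → Prop} (hE : Sys L S S' E) {R' : ℕ → ℕ∞} {k : ℕ}
    (hM' : IsRandom L M' R' k) (hR' : 0 < R' (Nat.card M')) (hk : 0 < k) {X X' : Set (V M t)}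
    {Y Y' : Set (V M' t)} (hX : X ⊆ S.N) (h : SetCorr L E X Y) (h' : SetCorr L E X' Y')
    (hY : Y ⊆ Y') : X ⊆ X' := by
  intro x hx
  obtain ⟨y, hy⟩ := hE.exists_corr hM' hR' hk (hX hx)
  exact (h' x y hy).2 (hY ((h x y hy).1 hx))

theorem SetCorr.eq_iff [IsEmpty (L.Relations 0)] [Finite M] [Finite M'] {S : Stage M m t}
    {S' : Stage M' m t} {E : V M t → V M' t → Prop} (hE : Sys L S S' E) {R R' : ℕ → ℕ∞} {k : ℕ}
    (hM : IsRandom L M R k) (hR : 0 < R (Nat.card M))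
    (hM' : IsRandom L M' R' k) (hR' : 0 < R' (Nat.card M')) (hk : 0 < k) {X X' : Set (V M t)}
    {Y Y' : Set (V M' t)} (hX : X ⊆ S.N) (hX' : X' ⊆ S.N) (hY : Y ⊆ S'.N) (hY' : Y' ⊆ S'.N)
    (h : SetCorr L E X Y) (h' : SetCorr L E X' Y') : X = X' ↔ Y = Y' := by
  constructor
  · intro e
    exact (SetCorr.subset hE.symm hM hR hk hY h.symm h'.symm e.subset).antisymm
      (SetCorr.subset hE.symm hM hR hk hY' h'.symm h.symm e.superset)
  · intro e
    exact (h.subset hE hM' hR' hk hX h' e.subset).antisymm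
      (h'.subset hE hM' hR' hk hX' h e.superset)

variable [L.IsRelational] {Υ : Scheme L}

/-- The correspondence between the sets of the next stages: two sets correspond if they have
corresponding elements. -/
def NextCorr (S : Stage M Υ.m₁ t) (S' : Stage M' Υ.m₁ t) (E : V M t → V M' t → Prop)
    (x : V M (t + 1)) (y : V M' (t + 1)) : Prop :=
  x ∈ S.nextN Υ ∧ y ∈ S'.nextN Υ ∧ ∃ X Y, x = ofSet X ∧ y = ofSet Y ∧ SetCorr L E X Y

theorem NextCorr.symm {S : Stage M Υ.m₁ t} {S' : Stage M' Υ.m₁ t} {E : V M t → V M' t → Prop}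
    {x : V M (t + 1)} {y : V M' (t + 1)} (h : NextCorr S S' E x y) :
    NextCorr S' S (flip E) y x := by
  obtain ⟨hx, hy, X, Y, hX, hY, h⟩ := h
  exact ⟨hy, hx, Y, X, hY, hX, h.symm⟩

theorem NextCorr.lift {S : Stage M Υ.m₁ t} {S' : Stage M' Υ.m₁ t} {E : V M t → V M' t → Prop}
    (hE : Sys L S S' E) {x : V M t} {y : V M' t} (h : E x y) :
    NextCorr S S' E (lift t x) (lift t y) :=
  ⟨Or.inl ⟨x, hE.left_mem x y h, rfl⟩, Or.inl ⟨y, hE.right_mem x y h, rfl⟩, _, _,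
    lift_eq_ofSet t x (hE.left_ne x y h), lift_eq_ofSet t y (hE.right_ne x y h),
    fun _ _ hz => hE.mem_iff _ _ _ _ hz h⟩

theorem NextCorr.eq_iff [IsEmpty (L.Relations 0)] [Finite M] [Finite M'] {S : Stage M Υ.m₁ t}
    {S' : Stage M' Υ.m₁ t} {E : V M t → V M' t → Prop} (hE : Sys L S S' E) (hS : S.Regular)
    (hS' : S'.Regular) {R R' : ℕ → ℕ∞} {k : ℕ}
    (hM : IsRandom L M R k) (hR : 0 < R (Nat.card M))
    (hM' : IsRandom L M' R' k) (hR' : 0 < R' (Nat.card M')) (hk : 0 < k)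
    {x x' : V M (t + 1)} {y y' : V M' (t + 1)} (h : NextCorr S S' E x y)
    (h' : NextCorr S S' E x' y') : x = x' ↔ y = y' := by
  obtain ⟨hx, hy, X, Y, rfl, rfl, h⟩ := h
  obtain ⟨hx', hy', X', Y', rfl, rfl, h'⟩ := h'
  rw [ofSet_injective.eq_iff, ofSet_injective.eq_iff]
  exact h.eq_iff hE hM hR hM' hR' hk (hS.subset_of_ofSet_mem hx) (hS.subset_of_ofSet_mem hx')
    (hS'.subset_of_ofSet_mem hy) (hS'.subset_of_ofSet_mem hy') h'

/-- Members of a set in the next stage come from the old stage. If `x` lifts an old set `z`, then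
the lift of the old partner of `z` also corresponds to `x`, so by uniqueness it is `y`. -/
theorem NextCorr.mem_of_mem [IsEmpty (L.Relations 0)] [Finite M] [Finite M']
    {S : Stage M Υ.m₁ t} {S' : Stage M' Υ.m₁ t} {E : V M t → V M' t → Prop} (hE : Sys L S S' E)
    (hS : S.Regular) (hS' : S'.Regular) {R R' : ℕ → ℕ∞} {k : ℕ}
    (hM : IsRandom L M R k) (hR : 0 < R (Nat.card M))
    (hM' : IsRandom L M' R' k) (hR' : 0 < R' (Nat.card M')) (hk : 0 < k)
    {x x' : V M (t + 1)} {y y' : V M' (t + 1)} (h : Corr L (NextCorr S S' E) x y)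
    (h' : NextCorr S S' E x' y') (hx : mem (t + 1) x x') : mem (t + 1) y y' := by
  obtain ⟨hx', hy', X, Y, rfl, rfl, hXY⟩ := h'
  obtain ⟨z, hz, rfl⟩ := mem_ofSet.1 hx
  have hzN := hS.subset_of_ofSet_mem hx' hz
  suffices H : ∃ z', Corr L E z z' ∧ CPT.lift t z' = y by
    obtain ⟨z', hzz', rfl⟩ := H
    exact lift_mem_ofSet.2 ((hXY z z' hzz').1 hz)
  rcases h with h | ⟨a, b, ha, rfl, hab⟩
  · have hz : ∀ a, z ≠ ur t a := by
      rintro a rfl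
      obtain ⟨-, -, X, -, hX, -⟩ := h
      rw [lift_ur] at hX
      exact ofSet_ne_ur X a hX.symm
    obtain ⟨z', hz'⟩ := (hE.left_total z hzN).resolve_left fun ⟨a, ha⟩ => hz a ha
    exact ⟨z', Or.inl hz',
      ((NextCorr.lift hE hz').eq_iff hE hS hS' hM hR hM' hR' hk h).1 rfl⟩
  · rw [← lift_ur] at ha
    exact ⟨ur t b, Or.inr ⟨a, b, lift_injective t ha, rfl, hab⟩, lift_ur t b⟩

/-- Old sets keep their partners. A newly defined set is matched with the set that the same formula
defines from matched parameters. -/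
theorem NextCorr.left_total [IsEmpty (L.Relations 0)] [Finite M] [Finite M'] [Nonempty M]
    [Nonempty M'] {S : Stage M Υ.m₁ t} {S' : Stage M' Υ.m₁ t} {E : V M t → V M' t → Prop}
    (hE : Sys L S S' E) (hS : S.Regular) (hS' : S'.Regular) {R R' : ℕ → ℕ∞} {k s : ℕ}
    (hM : IsRandom L M R k) (hM' : IsRandom L M' R' k) (hR' : 0 < R' (Nat.card M')) (hs : 0 < s)
    (hsk : 3 * s ≤ k) (hΥ : Υ.Bounded s) (hfew : ∀ l, (S.family Υ l).encard < R (Nat.card M))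
    (hfew' : ∀ l, (S'.family Υ l).encard < R' (Nat.card M')) {x : V M (t + 1)}
    (hx : x ∈ S.nextN Υ) : (∃ a, x = ur (t + 1) a) ∨ ∃ y, NextCorr S S' E x y := by
  rcases hx with ⟨u, hu, rfl⟩ | ⟨X, hX, rfl⟩
  · rcases hE.left_total u hu with ⟨a, rfl⟩ | ⟨w, hw⟩
    · exact Or.inl ⟨a, lift_ur t a⟩
    · exact Or.inr ⟨_, NextCorr.lift hE hw⟩
  · obtain ⟨l, hl⟩ := Set.mem_iUnion.1 hX
    obtain ⟨b, hb⟩ := hl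
    have hr := hΥ.1 l
    obtain ⟨b', hb'⟩ := hE.exists_tuple hS' hM' hR' (by omega) b
    have hY : defSet S' (Υ.ψ l) b' ∈ S'.family Υ l := ⟨b', rfl⟩
    refine Or.inr ⟨ofSet (defSet S' (Υ.ψ l) b'), Or.inr ⟨X, hX, rfl⟩,
      Or.inr ⟨_, Set.mem_iUnion.2 ⟨l, hY⟩, rfl⟩, _, _, rfl, rfl, fun z z' hz => ?_⟩
    rw [hb]
    exact mem_defSet_iff_of_corr hE hS hS' hM hM' hs hsk (hΥ.2.1 l) hr (hfew l) (hfew' l) hb' hz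

theorem Sys.c_corr [IsEmpty (L.Relations 0)] [Finite M] [Finite M'] [Nonempty M]
    [Nonempty M'] {S : Stage M Υ.m₁ t} {S' : Stage M' Υ.m₁ t} {E : V M t → V M' t → Prop}
    (hE : Sys L S S' E) (hS : S.Regular) (hS' : S'.Regular) {R R' : ℕ → ℕ∞} {k s : ℕ}
    (hM : IsRandom L M R k) (hR : 0 < R (Nat.card M)) (hM' : IsRandom L M' R' k)
    (hR' : 0 < R' (Nat.card M')) (hsk : s ≤ k) (hΥ : Υ.Bounded s) (ℓ : Fin Υ.m₁) :
    SetCorr L E (S.c Υ ℓ) (S'.c Υ ℓ) := by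
  intro z z' hz
  have hzN := hz.left_mem hE hS
  have hzN' := hz.symm.left_mem hE.symm hS'
  have := Good.sat_iff hE hS hS' hM hR hM' hR' hsk (Υ.φ ℓ) (hΥ.2.2 ℓ) (fun _ => ⟨z, hzN⟩)
    (fun _ => ⟨z', hzN'⟩) ((hz.good hE).mono (by rintro _ ⟨_, rfl⟩; rfl))
  exact ⟨fun h => ⟨hzN', this.1 h.2⟩, fun h => ⟨hzN, this.2 h.2⟩⟩

theorem NextCorr.pred_iff [IsEmpty (L.Relations 0)] [Finite M] [Finite M'] [Nonempty M]
    [Nonempty M'] {S : Stage M Υ.m₁ t} {S' : Stage M' Υ.m₁ t} {E : V M t → V M' t → Prop}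
    (hE : Sys L S S' E) (hS : S.Regular) (hS' : S'.Regular) {R R' : ℕ → ℕ∞} {k s : ℕ}
    (hM : IsRandom L M R k) (hR : 0 < R (Nat.card M)) (hM' : IsRandom L M' R' k)
    (hR' : 0 < R' (Nat.card M')) (hk : 0 < k) (hsk : s ≤ k) (hΥ : Υ.Bounded s)
    {x : V M (t + 1)} {y : V M' (t + 1)} (h : NextCorr S S' E x y) (ℓ : Fin Υ.m₁) :
    x ∈ (S.next Υ).P ℓ ↔ y ∈ (S'.next Υ).P ℓ := by
  obtain ⟨hx, hy, X, Y, rfl, rfl, h⟩ := h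
  refine (and_iff_right hx).trans (Iff.trans ?_ (and_iff_right hy).symm)
  rw [ofSet_injective.eq_iff, ofSet_injective.eq_iff]
  exact h.eq_iff hE hM hR hM' hR' hk (hS.subset_of_ofSet_mem hx) (S.c_subset ℓ)
    (hS'.subset_of_ofSet_mem hy) (S'.c_subset ℓ) (hE.c_corr hS hS' hM hR hM' hR' hsk hΥ ℓ)

/-- If the families of new sets are small, then a correspondence extends to the next stages. -/
theorem Sys.next [IsEmpty (L.Relations 0)] [Finite M] [Finite M'] [Nonempty M]
    [Nonempty M'] {S : Stage M Υ.m₁ t} {S' : Stage M' Υ.m₁ t} {E : V M t → V M' t → Prop}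
    (hE : Sys L S S' E) (hS : S.Regular) (hS' : S'.Regular) {R R' : ℕ → ℕ∞} {k s : ℕ}
    (hM : IsRandom L M R k) (hR : 0 < R (Nat.card M)) (hM' : IsRandom L M' R' k)
    (hR' : 0 < R' (Nat.card M')) (hs : 0 < s)
    (hsk : 3 * s ≤ k) (hΥ : Υ.Bounded s) (hfew : ∀ l, (S.family Υ l).encard < R (Nat.card M))
    (hfew' : ∀ l, (S'.family Υ l).encard < R' (Nat.card M')) :
    Sys L (S.next Υ) (S'.next Υ) (NextCorr S S' E) where
  left_mem x y h := h.1
  right_mem x y h := h.2.1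
  left_ne := by
    rintro x y ⟨-, -, X, Y, rfl, -⟩
    exact ofSet_ne_ur X
  right_ne := by
    rintro x y ⟨-, -, X, Y, -, rfl, -⟩
    exact ofSet_ne_ur Y
  left_total x hx := NextCorr.left_total hE hS hS' hM hM' hR' hs hsk hΥ hfew hfew' hx
  right_total y hy :=
    (NextCorr.left_total hE.symm hS' hS hM' hM hR hs hsk hΥ hfew' hfew hy).imp_right
      fun ⟨x, hx⟩ => ⟨x, hx.symm⟩
  inj x y x' y' h h' := h.eq_iff hE hS hS' hM hR hM' hR' (by omega) h'
  mem_iff x y x' y' h h' :=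
    ⟨NextCorr.mem_of_mem hE hS hS' hM hR hM' hR' (by omega) h h',
      NextCorr.mem_of_mem hE.symm hS' hS hM' hR' hM hR (by omega)
        (h.symm.imp_left NextCorr.symm) h'.symm⟩
  pred_iff x y h ℓ := h.pred_iff hE hS hS' hM hR hM' hR' (by omega) (by omega) hΥ ℓ

theorem exists_sys_run [IsEmpty (L.Relations 0)] [Finite M] [Finite M'] [Nonempty M]
    [Nonempty M'] {R R' : ℕ → ℕ∞} {k s : ℕ} (hM : IsRandom L M R k) (hR : 0 < R (Nat.card M))
    (hM' : IsRandom L M' R' k) (hR' : 0 < R' (Nat.card M')) (hs : 0 < s)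
    (hsk : 3 * s ≤ k) (hΥ : Υ.Bounded s) (t : ℕ)
    (hfew : ∀ i < t, ∀ l, ((run M Υ i).family Υ l).encard < R (Nat.card M))
    (hfew' : ∀ i < t, ∀ l, ((run M' Υ i).family Υ l).encard < R' (Nat.card M')) :
    ∃ E, Sys L (run M Υ t) (run M' Υ t) E := by
  induction t with
  | zero =>
    -- At time `0` there are only urelements, so the empty correspondence serves.
    exact ⟨fun _ _ => False, ⟨fun _ _ h => h.elim, fun _ _ h => h.elim, fun _ _ h => h.elim,
      fun _ _ h => h.elim, fun x _ => Or.inl ⟨x, rfl⟩, fun y _ => Or.inl ⟨y, rfl⟩,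
      fun _ _ _ _ h => h.elim, fun _ _ _ _ _ h => h.elim, fun _ _ h => h.elim⟩⟩
  | succ t ih =>
    obtain ⟨E, hE⟩ := ih (fun i hi => hfew i (hi.trans t.lt_succ_self))
      (fun i hi => hfew' i (hi.trans t.lt_succ_self))
    exact ⟨_, hE.next (run_regular M Υ t) (run_regular M' Υ t) hM hR hM' hR' hs hsk hΥ
      (hfew t t.lt_succ_self) (hfew' t t.lt_succ_self)⟩

end Step

/-! ### Stopping times -/

section Stop

variable {L : FirstOrder.Language.{u, v}} [L.IsRelational] {M : Type w} {M' : Type w'}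
  [L.Structure M] [L.Structure M'] {Υ : Scheme L} {χ : (plus L).Sentence} {T T' : ℕ → ℕ∞}
  {ι : Mode}

/-- The one consequence of the budget needed in the comparison, common to all three ways of
charging. -/
theorem encard_family_le_of_not_exceeds {B : ℕ∞} {t : ℕ} (h : ¬ Exceeds M Υ B t ι)
    (l : Fin Υ.m₀) : ((run M Υ t).family Υ l).encard ≤ B := by
  have hN : ((run M Υ t).family Υ l).encard ≤ (run M Υ (t + 1)).N.encard := by
    rw [← ofSet_injective.encard_image]
    refine Set.encard_le_encard ?_
    rintro _ ⟨X, hX, rfl⟩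
    exact Or.inr ⟨X, Set.mem_iUnion.2 ⟨l, hX⟩, rfl⟩
  cases ι with
  | two => exact (hN.trans le_self_add).trans (not_lt.1 h)
  | three => exact hN.trans (not_lt.1 h)
  | four => exact not_lt.1 fun hl => h ⟨l, hl⟩

theorem stopTime_le {t : ℕ} (h : Stops M Υ (T (Nat.card M)) ι t) : stopTime M Υ T ι ≤ t :=
  sInf_le ⟨t, rfl, h⟩

theorem not_stops_of_lt_stopTime {t : ℕ} (h : (t : ℕ∞) < stopTime M Υ T ι) :
    ¬ Stops M Υ (T (Nat.card M)) ι t :=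
  fun hs => (stopTime_le hs).not_gt h

theorem not_stops_of_lt {t t' : ℕ} (h : (t : ℕ∞) ≤ stopTime M Υ T ι) (ht : t' < t) :
    ¬ Stops M Υ (T (Nat.card M)) ι t' :=
  not_stops_of_lt_stopTime (lt_of_lt_of_le (by exact_mod_cast ht) h)

/-- The computation is not stopped before time `t`. -/
def Running (M : Type w) [L.Structure M] (Υ : Scheme L) (T : ℕ → ℕ∞) (ι : Mode) (t : ℕ) : Prop :=
  ∀ t' < t, ¬ Stops M Υ (T (Nat.card M)) ι t'

/-- Otherwise both computations are still running when the second reaches its target, so the first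
reaches it at the same time and its truth value is defined. -/
theorem stopTime_lt_of_not_defined
    (H : ∀ t, Running M Υ T ι t → Running M' Υ T' ι t → (Halts M Υ t ↔ Halts M' Υ t))
    (h : ¬ Defined M Υ T ι) (h' : Defined M' Υ T' ι) :
    stopTime M Υ T ι < stopTime M' Υ T' ι := by
  obtain ⟨t, ht, hh⟩ := h'
  by_contra hlt
  rw [not_lt, ht] at hlt
  have := (H t (fun _ => not_stops_of_lt hlt) (fun _ => not_stops_of_lt ht.ge)).2 hh
  exact h ⟨t, (stopTime_le (Or.inl this)).antisymm hlt, this⟩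

theorem stopTime_le_of_defined
    (H : ∀ t, Running M Υ T ι t → Running M' Υ T' ι t → (Halts M Υ t ↔ Halts M' Υ t))
    (h : Defined M Υ T ι) : stopTime M' Υ T' ι ≤ stopTime M Υ T ι := by
  obtain ⟨t, ht, hh⟩ := h
  by_contra hlt
  rw [not_le, ht] at hlt
  exact not_stops_of_lt_stopTime hlt (Or.inl ((H t (fun _ => not_stops_of_lt ht.ge)
    (fun _ => not_stops_of_lt hlt.le)).1 hh))

/-- Computations which agree as long as they are running have the same truth value, except if one
of them is stopped before the other one reaches its target. -/
theorem truthValue_eq_or_of_agree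
    (H : ∀ t, Running M Υ T ι t → Running M' Υ T' ι t →
      (Halts M Υ t ↔ Halts M' Υ t) ∧ ((run M Υ t).SatSentence χ ↔ (run M' Υ t).SatSentence χ)) :
    truthValue M Υ χ T ι = truthValue M' Υ χ T' ι ∨
    (¬ Defined M Υ T ι ∧ Defined M' Υ T' ι ∧ stopTime M Υ T ι < stopTime M' Υ T' ι) ∨
    (¬ Defined M' Υ T' ι ∧ Defined M Υ T ι ∧ stopTime M' Υ T' ι < stopTime M Υ T ι) := by
  have H₁ := fun t h h' => (H t h h').1
  have H₂ := fun t h' h => (H₁ t h h').symm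
  by_cases h : Defined M Υ T ι <;> by_cases h' : Defined M' Υ T' ι
  · left
    have heq := (stopTime_le_of_defined H₂ h').antisymm (stopTime_le_of_defined H₁ h)
    have hH : Holds M Υ χ T ι ↔ Holds M' Υ χ T' ι := by
      refine exists_congr fun t => ?_
      rw [← heq]
      refine and_congr_right fun ht => ?_
      have := H t (fun _ => not_stops_of_lt ht.ge) (fun _ => not_stops_of_lt (heq ▸ ht.ge))
      rw [this.1, this.2]
    rw [truthValue, truthValue, if_pos h, if_pos h', hH]
  · exact Or.inr (Or.inr ⟨h', h, stopTime_lt_of_not_defined H₂ h' h⟩)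
  · exact Or.inr (Or.inl ⟨h, h', stopTime_lt_of_not_defined H₁ h h'⟩)
  · left
    rw [truthValue, truthValue, if_neg h, if_neg h']

/-- A formula that does not depend on its argument defines either the whole stage or the empty set,
and these differ because the stage contains `a`. -/
theorem c_eq_iff_of_const {t : ℕ} {S : Stage M Υ.m₁ t} (a : S.N)
    (h : ∀ ℓ (x : S.N), S.Sat (Υ.φ ℓ) (fun _ => x) ↔ S.Sat (Υ.φ ℓ) (fun _ => a))
    (i j : Fin Υ.m₁) :
    S.c Υ i = S.c Υ j ↔ (S.Sat (Υ.φ i) (fun _ => a) ↔ S.Sat (Υ.φ j) (fun _ => a)) := by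
  have hmem : ∀ ℓ x (_ : x ∈ S.N), x ∈ S.c Υ ℓ ↔ S.Sat (Υ.φ ℓ) (fun _ => a) :=
    fun ℓ x hx => (exists_prop_of_true hx).trans (h ℓ ⟨x, hx⟩)
  constructor
  · intro h
    rw [← hmem i a a.2, ← hmem j a a.2, h]
  · intro h
    ext x
    by_cases hx : x ∈ S.N
    · rw [hmem i x hx, hmem j x hx, h]
    · exact iff_of_false (fun h => hx h.1) (fun h => hx h.1)

/-- Without free variables, neither the target condition nor the truth of a sentence depends on the
model. -/
theorem agree_of_width_zero [IsEmpty (L.Relations 0)] [Nonempty M] [Nonempty M']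
    (hΥ : Υ.Bounded 0) (hχ : WidthLE 0 χ) (t : ℕ) :
    (Halts M Υ t ↔ Halts M' Υ t) ∧ ((run M Υ t).SatSentence χ ↔ (run M' Υ t).SatSentence χ) := by
  let a : (run M Υ t).N := ⟨_, (run_regular M Υ t).ur_mem (Classical.arbitrary M)⟩
  let a' : (run M' Υ t).N := ⟨_, (run_regular M' Υ t).ur_mem (Classical.arbitrary M')⟩
  have : Nonempty (run M Υ t).N := ⟨a⟩
  have : Nonempty (run M' Υ t).N := ⟨a'⟩
  have hsat : ∀ ℓ (x : (run M Υ t).N) (x' : (run M' Υ t).N),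
      (run M Υ t).Sat (Υ.φ ℓ) (fun _ => x) ↔ (run M' Υ t).Sat (Υ.φ ℓ) (fun _ => x') := by
    intro ℓ x x'
    let _ := dynStructure (run M Υ t).N (run M Υ t).P
    let _ := dynStructure (run M' Υ t).N (run M' Υ t).P
    refine realize_iff_of_widthLE_zero ⟨?_⟩ (Υ.φ ℓ) (hΥ.2.2 ℓ) _ _ _ _
    rintro ((R | R) | R)
    · exact isEmptyElim R
    · cases R
    · cases R
  constructor
  · refine exists_congr fun i => exists_congr fun j => and_congr_right fun _ =>
      and_congr_right fun _ => ?_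
    rw [c_eq_iff_of_const a fun ℓ x => (hsat ℓ x a').trans (hsat ℓ a a').symm,
      c_eq_iff_of_const a' fun ℓ x => (hsat ℓ a x).symm.trans (hsat ℓ a a'), hsat i a a', hsat j a a']
  · refine realize_iff_of_widthLE_zero ⟨?_⟩ χ hχ _ _ _ _
    rintro (R | R)
    · exact isEmptyElim R
    · cases R

/-- In random models computations agree as long as they have produced few sets. -/
theorem agree_of_few [IsEmpty (L.Relations 0)] [Finite M] [Finite M'] [Nonempty M] [Nonempty M']
    {R R' : ℕ → ℕ∞} {k s : ℕ} (hM : IsRandom L M R k) (hR : 0 < R (Nat.card M))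
    (hM' : IsRandom L M' R' k) (hR' : 0 < R' (Nat.card M'))
    (hsk : 3 * s ≤ k) (hΥ : Υ.Bounded s) (hχ : WidthLE s χ) (t : ℕ)
    (hfew : ∀ i < t, ∀ l, ((run M Υ i).family Υ l).encard < R (Nat.card M))
    (hfew' : ∀ i < t, ∀ l, ((run M' Υ i).family Υ l).encard < R' (Nat.card M')) :
    (Halts M Υ t ↔ Halts M' Υ t) ∧ ((run M Υ t).SatSentence χ ↔ (run M' Υ t).SatSentence χ) := by
  -- For `s = 0` the bound `3 * s ≤ k` allows `k = 0`, where randomness says nothing; formulas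
  -- without free variables are handled directly.
  rcases s.eq_zero_or_pos with rfl | hs
  · exact agree_of_width_zero hΥ hχ t
  obtain ⟨E, hE⟩ := exists_sys_run hM hR hM' hR' hs hsk hΥ t hfew hfew'
  have hreg := run_regular M Υ t
  have hreg' := run_regular M' Υ t
  refine ⟨?_, hE.satSentence_iff hreg hreg' hM hR hM' hR' (by omega) χ hχ⟩
  refine exists_congr fun i => exists_congr fun j => and_congr_right fun _ =>
    and_congr_right fun _ => ?_
  exact (hE.c_corr hreg hreg' hM hR hM' hR' (by omega) hΥ i).eq_iff hE hM hR hM' hR' (by omega)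
    (Stage.c_subset _ i) (Stage.c_subset _ j) (Stage.c_subset _ i) (Stage.c_subset _ j)
    (hE.c_corr hreg hreg' hM hR hM' hR' (by omega) hΥ j)

end Stop

end CPT

theorem mainTheorem2 {L : FirstOrder.Language.{u, v}} [L.IsRelational]
    [Finite (Σ n, L.Relations n)] [IsEmpty (L.Relations 0)]
    {M₁ : Type w} {M₂ : Type w'} [L.Structure M₁] [L.Structure M₂]
    [Finite M₁] [Finite M₂] [Nonempty M₁] [Nonempty M₂]
    (k s : ℕ) (S₁ S₂ T₁ T₂ : ℕ → ℕ∞)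
    (hM₁ : CPT.IsRandom L M₁ S₁ k) (hM₂ : CPT.IsRandom L M₂ S₂ k)
    (hsk : 3 * s ≤ k)
    (hT₁ : ((2 ^ (2 ^ s * Nat.card (Σ n, L.Relations n)) : ℕ) : ℕ∞) < T₁ (Nat.card M₁))
    (hS₁ : T₁ (Nat.card M₁) + (s : ℕ∞) < S₁ (Nat.card M₁))
    (hT₂ : ((2 ^ (2 ^ s * Nat.card (Σ n, L.Relations n)) : ℕ) : ℕ∞) < T₂ (Nat.card M₂))
    (hS₂ : T₂ (Nat.card M₂) + (s : ℕ∞) < S₂ (Nat.card M₂))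
    (Υ : CPT.Scheme L) (χ : (CPT.plus L).Sentence)
    (hΥ : Υ.Bounded s) (hχ : CPT.WidthLE s χ) (ι : CPT.Mode) :
    CPT.truthValue M₁ Υ χ T₁ ι = CPT.truthValue M₂ Υ χ T₂ ι ∨
    (¬ CPT.Defined M₁ Υ T₁ ι ∧ CPT.Defined M₂ Υ T₂ ι ∧
      CPT.stopTime M₁ Υ T₁ ι < CPT.stopTime M₂ Υ T₂ ι) ∨
    (¬ CPT.Defined M₂ Υ T₂ ι ∧ CPT.Defined M₁ Υ T₁ ι ∧
      CPT.stopTime M₂ Υ T₂ ι < CPT.stopTime M₁ Υ T₁ ι) := by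
  -- A step that was taken was affordable, so its families have at most `T` members, strictly fewer
  -- than the number of realizations of a type.
  have hlt : ∀ {T S x : ℕ∞}, T + (s : ℕ∞) < S → x ≤ T → x < S := fun h hx =>
    (hx.trans le_self_add).trans_lt h
  refine CPT.truthValue_eq_or_of_agree fun t h₁ h₂ =>
    CPT.agree_of_few hM₁ (hlt hS₁ (zero_le)) hM₂ (hlt hS₂ (zero_le)) hsk hΥ hχ t ?_ ?_
  · exact fun i hi l => hlt hS₁ (CPT.encard_family_le_of_not_exceeds
      (fun h => h₁ i hi (Or.inr (Or.inl h))) l)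
  · exact fun i hi l => hlt hS₂ (CPT.encard_family_le_of_not_exceeds
      (fun h => h₂ i hi (Or.inr (Or.inl h))) l)
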